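/- Let $U=(u_{ij})$ be a real $N\times M$ matrix, and suppose that the zero-sum game $\min_{x\in\Delta_N}\max_{y\in\Delta_M}x^\top Uy$ (where $\Delta_N,\Delta_M$ are the probability simplices) has a fully mixed Nash equilibrium $(p,q)$, i.e. all $p_i>0$ and all $q_j>0$. Given $f_i:\mathbb R^{n_i}\to\mathbb R$ ($1\le i\le N$) and $g_j:\mathbb R^{m_j}\to\mathbb R$ ($1\le j\le M$), consider on the state space of all $(\theta,\phi,\lambda,\mu)$ with $\theta_i\in\mathbb R^{n_i}$, $\phi_j\in\mathbb R^{m_j}$, $\lambda,\mu\in\mathbb R$, the Lagrangian-constrained continuous-time gradient-descent-ascent system $$\dot\theta_i=-\nabla f_i(\theta_i)\Big(\sum_{j}u_{ij}g_j(\phi_j)+\lambda\Big),\qquad \dot\phi_j=\nabla g_j(\phi_j)\Big(\sum_{i}u_{ij}f_i(\theta_i)+\mu\Big),$$ $$\dot\mu=-\Big(\sum_{j}g_j(\phi_j)-1\Big),\qquad \dot\lambda=\sum_{i}f_i(\theta_i)-1 .$$ Its flow, when it exists, is the continuous map $\Phi$ such that for every $x_0$, $\Phi(x_0,\cdot)$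 is the unique solution on all of $\mathbb R$ with initial value $x_0$. A point $x$ is recurrent if for each neighbourhood $O$ of $x$ there are times $t_1<t_2<\cdots\to\infty$ with $\Phi(x,t_k)\in O$ for all $k$. The flow is Poincaré recurrent if the set of non-recurrent points of the state space has Lebesgue measure zero. An initialization $(\theta,\phi,\lambda,\mu)$ is safe if for all $i,j$ one has $\nabla f_i(\theta_i)\ne0$ and $\nabla g_j(\phi_j)\neq 0$, and the value $p_i$ (resp. $q_j$) is attained by $f_i$ (resp. $g_j$) along the maximal (forward and backward in time) solution of the gradient ascent equation $\dot z=\nabla f_i(z)$ through $\theta_i$ (resp. $\dot z=\nabla g_j(z)$ through $\phi_j$). (1) If $N,M\ge2$ and every $f_i$ and $g_j$ is the sigmoid $\sigma(x)=(1+e^{-x})^{-1}$ on $\mathbb R$, then the flow of the system exists and is Poincaré recurrent. (2) Suppose that all $f_i$ and $g_j$ are $C^2$ and injective and that every initialization is safe. If for every initial value the system has a solution on all of $\mathbb R$, then its flow exists and is Poincaré recurrent. These solutions on all of $\mathbb R$ do exist whenever, for all $i,j$, every solution of the gradient ascent equations of $f_i$ and $g_j$ extends to all of $\mathbb R$. 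-/

import Mathlib

open Set Filter Topology MeasureTheory

noncomputable section

namespace HiddenBilinear

/-! ### Flows and recurrence -/

section Flow

variable {X : Type*} [NormedAddCommGroup X] [NormedSpace ℝ X]

/-- `γ` is a solution, defined for all times, of the autonomous system `ẋ = V x`. -/
def IsGlobalSolution (V : X → X) (γ : ℝ → X) : Prop :=
  ∀ t : ℝ, HasDerivAt γ (V (γ t)) t

/-- Every initial value problem of `ẋ = V x` has a solution defined for all times. -/
def HasGlobalSolutions (V : X → X) : Prop :=
  ∀ x₀ : X, ∃ γ : ℝ → X, γ 0 = x₀ ∧ IsGlobalSolution V γ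

/-- `Φ` is the flow of `ẋ = V x`: a jointly continuous map such that `Φ x₀` is the unique solution
of the initial value problem with initial value `x₀`. -/
structure IsFlow (V : X → X) (Φ : X → ℝ → X) : Prop where
  continuous : Continuous (fun z : X × ℝ => Φ z.1 z.2)
  initial : ∀ x₀ : X, Φ x₀ 0 = x₀
  solution : ∀ x₀ : X, IsGlobalSolution V (Φ x₀)
  unique : ∀ (x₀ : X) (γ : ℝ → X), γ 0 = x₀ → IsGlobalSolution V γ → γ = Φ x₀

end Flow

/-- `x` is recurrent under `Φ`: for every neighbourhood `U` of `x` there is an increasing sequence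
of times tending to infinity at which the trajectory of `x` lies in `U`. -/
def IsRecurrentPoint {X : Type*} [TopologicalSpace X] (Φ : X → ℝ → X) (x : X) : Prop :=
  ∀ U ∈ 𝓝 x, ∃ t : ℕ → ℝ, StrictMono t ∧ Tendsto t atTop atTop ∧ ∀ k : ℕ, Φ x (t k) ∈ U

/-- `Φ` is Poincaré recurrent in the set `A` of non-zero measure: the non-recurrent points of `A`
form a null set. -/
def IsPoincareRecurrentOn {X : Type*} [TopologicalSpace X] [MeasureSpace X]
    (Φ : X → ℝ → X) (A : Set X) : Prop :=
  volume A ≠ 0 ∧ volume {x | x ∈ A ∧ ¬ IsRecurrentPoint Φ x} = 0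

/-! ### Gradient ascent -/

/-- The set of values that `k` attains along the gradient ascent trajectory `γ̇ = ∇ k (γ)` with
`γ 0 = x₀`, over its whole (possibly bounded) open time interval of existence. -/
def attainableValues {d : ℕ} (k : EuclideanSpace ℝ (Fin d) → ℝ) (x₀ : EuclideanSpace ℝ (Fin d)) :
    Set ℝ :=
  {y | ∃ (I : Set ℝ) (γ : ℝ → EuclideanSpace ℝ (Fin d)),
    IsOpen I ∧ I.OrdConnected ∧ (0 : ℝ) ∈ I ∧ γ 0 = x₀ ∧
    (∀ t ∈ I, HasDerivAt γ (gradient k (γ t)) t) ∧ ∃ t ∈ I, k (γ t) = y}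

/-! ### Hidden bilinear games with separable `F`, `G` -/

variable {N M : ℕ}

/-- States `(θ, φ, lam, mu)`, where `θ i ∈ ℝ^(n i)` and `φ j ∈ ℝ^(m j)` are the parameters of the
two players and `lam`, `mu` are the Lagrange multipliers of the constraints `∑ i, f i = 1` and
`∑ j, g j = 1`. -/
abbrev State (n : Fin N → ℕ) (m : Fin M → ℕ) : Type :=
  ((i : Fin N) → EuclideanSpace ℝ (Fin (n i))) × ((j : Fin M) → EuclideanSpace ℝ (Fin (m j))) ×
    ℝ × ℝ

/-- The vector field of the continuous-time gradient-descent-ascent dynamics of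
`min_{θ, mu} max_{φ, lam} F(θ)ᵀ U G(φ) + lam (∑ i, f i (θ i) - 1) + mu (∑ j, g j (φ j) - 1)`,
where `F(θ) = (f i (θ i))_i` and `G(φ) = (g j (φ j))_j`. -/
def cgdaField {n : Fin N → ℕ} {m : Fin M → ℕ} (U : Matrix (Fin N) (Fin M) ℝ)
    (f : (i : Fin N) → EuclideanSpace ℝ (Fin (n i)) → ℝ)
    (g : (j : Fin M) → EuclideanSpace ℝ (Fin (m j)) → ℝ) : State n m → State n m :=
  fun (θ, φ, lam, mu) =>
    (fun i => -((∑ j, U i j * g j (φ j) + lam) • gradient (f i) (θ i)),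
     fun j => (∑ i, U i j * f i (θ i) + mu) • gradient (g j) (φ j),
     ∑ i, f i (θ i) - 1,
     -(∑ j, g j (φ j) - 1))

/-- `(p, q)` is a fully mixed Nash equilibrium of the zero-sum game with payoff `xᵀ U y`, in which
the first player chooses `x` in the simplex to minimize and the second player chooses `y` in the
simplex to maximize. -/
structure IsFullyMixedNash (U : Matrix (Fin N) (Fin M) ℝ) (p : Fin N → ℝ) (q : Fin M → ℝ) :
    Prop where
  left_mem : p ∈ stdSimplex ℝ (Fin N)
  right_mem : q ∈ stdSimplex ℝ (Fin M)
  left_pos : ∀ i, 0 < p i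
  right_pos : ∀ j, 0 < q j
  left_opt : ∀ x ∈ stdSimplex ℝ (Fin N), p ⬝ᵥ U.mulVec q ≤ x ⬝ᵥ U.mulVec q
  right_opt : ∀ y ∈ stdSimplex ℝ (Fin M), p ⬝ᵥ U.mulVec y ≤ p ⬝ᵥ U.mulVec q

/-- The initialization `x = (θ, φ, lam, mu)` is safe with respect to `(p, q)`: no `θ i`, `φ j` is a
stationary point of `f i`, `g j`, and `p i`, `q j` are attained by `f i`, `g j` along the gradient
ascent trajectories through `θ i`, `φ j`. -/
structure IsSafe {n : Fin N → ℕ} {m : Fin M → ℕ}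
    (f : (i : Fin N) → EuclideanSpace ℝ (Fin (n i)) → ℝ)
    (g : (j : Fin M) → EuclideanSpace ℝ (Fin (m j)) → ℝ)
    (p : Fin N → ℝ) (q : Fin M → ℝ) (x : State n m) : Prop where
  left_nonstationary : ∀ i, gradient (f i) (x.1 i) ≠ 0
  right_nonstationary : ∀ j, gradient (g j) (x.2.1 j) ≠ 0
  left_attained : ∀ i, p i ∈ attainableValues (f i) (x.1 i)
  right_attained : ∀ j, q j ∈ attainableValues (g j) (x.2.1 j)

/-- The sigmoid `x ↦ (1 + exp (-x))⁻¹` as a function of a one-dimensional parameter vector. -/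
def sigmoidFun (x : EuclideanSpace ℝ (Fin 1)) : ℝ :=
  (1 + Real.exp (-(x 0)))⁻¹

end HiddenBilinear

end

/-!
Since an injective continuous real function lives on a space of dimension at most one, and a
stationary point is excluded, every parameter is a real number and every `f i`, `g j` is a `C²`
diffeomorphism of `ℝ` onto an open interval. A fully mixed equilibrium makes both players
indifferent between their pure strategies (`IsFullyMixedNash.indifferent`), so the multipliers
`mu`, `lam` can be treated as one more parameter of each player, with the identity as value function
and the payoff matrix bordered by ones (`stateEquiv_cgdaField`). The dynamics become
`θ i' = -f i' (θ i) * ∑ j, C i j * (g j (φ j) - q j)`,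
`φ j' = g j' (φ j) * ∑ i, C i j * (f i (θ i) - p i)`, without constraints (`hiddenField`).

Measure each parameter by the time that its gradient ascent needs to reach it (`ascentTime`). In
these coordinates the derivative factors disappear and the field is separable: `ẋ = A y`,
`ẏ = B x`. Two facts carry the proof.

* The flow of a separable field preserves the volume. For bounded Lipschitz fields it is the
  pointwise limit of the symplectic Euler method, each step of which is a composition of two shears
  (`measurePreserving_flow_separableField`). The actual field is reduced to this case by clamping
  its arguments to boxes, which changes nothing as long as trajectories stay in the box
  (`measurePreserving_flow_hiddenField`).
* With `F i`, `G j` the values as increasing functions of the ascent time, the energy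
  `∑ i, ∫ (F i - p i) + ∑ j, ∫ (G j - q j)` is conserved (`hasDerivAt_energy`). As `p i` and `q j`
  are interior values, each summand grows at least linearly, so its sublevel sets are bounded in
  ascent coordinates (`mul_sub_le_potential`).

If the ascent trajectories are global, then the ascent times range over `ℝ`, and the energy confines
each solution of a suitably clamped system to its box, so the solutions are global
(`hasGlobalSolutions_hiddenField`). In general the ascent times range over open intervals whose end
points may be finite, but the energy sublevel sets still have finite volume, and Poincaré's
recurrence theorem applies to the time-one map on each of them
(`volume_not_isRecurrentPoint_hiddenField`). Null sets in ascent coordinates are null sets of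
parameters because the inverse coordinate change is differentiable.
-/

noncomputable section

namespace HiddenBilinear

open scoped NNReal ENNReal

/-! ### Flows of bounded Lipschitz vector fields -/

section LipschitzFlow

variable {E : Type*} [NormedAddCommGroup E] [NormedSpace ℝ E]

lemma IsGlobalSolution.comp_neg {V : E → E} {γ : ℝ → E} (h : IsGlobalSolution V γ) :
    IsGlobalSolution (fun x => -V x) (fun t => γ (-t)) := by
  intro t
  have := (h (-t)).scomp t (hasDerivAt_neg t)
  rw [neg_one_smul] at this
  exact this

lemma IsGlobalSolution.comp_add {V : E → E} {γ : ℝ → E} (h : IsGlobalSolution V γ) (s : ℝ) :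
    IsGlobalSolution V (fun t => γ (s + t)) := by
  intro t
  exact (h (s + t)).comp_const_add s t

lemma IsGlobalSolution.continuous {V : E → E} {γ : ℝ → E} (h : IsGlobalSolution V γ) :
    Continuous γ :=
  continuous_iff_continuousAt.2 fun t => (h t).continuousAt

lemma IsFlow.flow_flow {V : E → E} {Φ : E → ℝ → E} (h : IsFlow V Φ) (x : E) (s t : ℝ) :
    Φ (Φ x s) t = Φ x (s + t) := by
  have := h.unique (Φ x s) (fun t => Φ x (s + t)) (by simp) ((h.solution x).comp_add s)
  exact (congrFun this t).symm

lemma dist_le_of_isGlobalSolution_of_nonneg {V : E → E} {K : ℝ≥0} (hV : LipschitzWith K V)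
    {γ δ : ℝ → E} (hγ : IsGlobalSolution V γ) (hδ : IsGlobalSolution V δ) {t : ℝ} (ht : 0 ≤ t) :
    dist (γ t) (δ t) ≤ dist (γ 0) (δ 0) * Real.exp (K * t) := by
  have := dist_le_of_trajectories_ODE (v := fun _ => V) (a := 0) (b := t) (fun _ => hV)
    hγ.continuous.continuousOn (fun s _ => (hγ s).hasDerivWithinAt)
    hδ.continuous.continuousOn (fun s _ => (hδ s).hasDerivWithinAt) le_rfl t ⟨ht, le_rfl⟩
  simpa using this

lemma dist_le_of_isGlobalSolution {V : E → E} {K : ℝ≥0} (hV : LipschitzWith K V)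
    {γ δ : ℝ → E} (hγ : IsGlobalSolution V γ) (hδ : IsGlobalSolution V δ) (t : ℝ) :
    dist (γ t) (δ t) ≤ dist (γ 0) (δ 0) * Real.exp (K * |t|) := by
  rcases le_total 0 t with ht | ht
  · rw [abs_of_nonneg ht]
    exact dist_le_of_isGlobalSolution_of_nonneg hV hγ hδ ht
  · rw [abs_of_nonpos ht]
    simpa using dist_le_of_isGlobalSolution_of_nonneg hV.neg hγ.comp_neg hδ.comp_neg
      (neg_nonneg.2 ht)

lemma IsGlobalSolution.lipschitzWith {V : E → E} {L : ℝ≥0} (hL : ∀ x, ‖V x‖ ≤ L)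
    {γ : ℝ → E} (hγ : IsGlobalSolution V γ) : LipschitzWith L γ :=
  lipschitzWith_of_nnnorm_deriv_le (fun t => (hγ t).differentiableAt) fun t => by
    rw [(hγ t).deriv]; exact hL _

lemma exists_isGlobalSolution_of_lipschitzWith_of_bounded [CompleteSpace E] {V : E → E} {K L : ℝ≥0}
    (hV : LipschitzWith K V) (hL : ∀ x, ‖V x‖ ≤ L) : HasGlobalSolutions V := by
  intro x₀
  have key : ∀ n : ℕ, ∃ α : ℝ → E, α 0 = x₀ ∧
      ∀ t ∈ Ioo (-(n + 1 : ℝ)) (n + 1), HasDerivAt α (V (α t)) t := by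
    intro n
    have h0 : (0 : ℝ) ∈ Icc (-(n + 1 : ℝ)) (n + 1) := ⟨by linarith, by positivity⟩
    have hPL : IsPicardLindelof (fun _ => V) (⟨0, h0⟩ : Icc (-(n + 1 : ℝ)) (n + 1)) x₀
        (L * (n + 1)) 0 L K :=
      { lipschitzOnWith := fun t _ => hV.lipschitzOnWith
        continuousOn := fun x _ => continuousOn_const
        norm_le := fun t _ x _ => hL x
        mul_max_le := by simp }
    obtain ⟨α, h1, h2⟩ := hPL.exists_eq_forall_mem_Icc_hasDerivWithinAt₀
    exact ⟨α, h1, fun t ht => (h2 t (Ioo_subset_Icc_self ht)).hasDerivAt (Icc_mem_nhds ht.1 ht.2)⟩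
  choose α hα0 hα using key
  -- solutions on nested intervals agree, so they glue to a solution on the whole line
  have hagree : ∀ m n : ℕ, m ≤ n → EqOn (α m) (α n) (Ioo (-(m + 1 : ℝ)) (m + 1)) := by
    intro m n hmn
    have hmn' : (m : ℝ) ≤ n := by exact_mod_cast hmn
    refine ODE_solution_unique_of_mem_Ioo (v := fun _ => V) (s := fun _ => univ) (K := K) (t₀ := 0)
      (fun t _ => hV.lipschitzOnWith) ⟨by linarith, by positivity⟩
      (fun t ht => ⟨hα m t ht, trivial⟩) (fun t ht => ⟨hα n t ⟨?_, ?_⟩, trivial⟩)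
      (by rw [hα0, hα0]) <;> linarith [ht.1, ht.2]
  have hval : ∀ (n : ℕ) (t : ℝ), |t| < n + 1 → α ⌈|t|⌉₊ t = α n t := by
    intro n t ht
    have h1 : |t| < ⌈|t|⌉₊ + 1 := (Nat.le_ceil _).trans_lt (lt_add_one _)
    rcases le_total ⌈|t|⌉₊ n with h | h
    · exact hagree _ _ h (abs_lt.1 h1)
    · exact (hagree _ _ h (abs_lt.1 ht)).symm
  refine ⟨fun t => α ⌈|t|⌉₊ t, by simp [hα0], fun t => ?_⟩
  have h1 : |t| < ⌈|t|⌉₊ + 1 := (Nat.le_ceil _).trans_lt (lt_add_one _)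
  refine (hα _ t (abs_lt.1 h1)).congr_of_eventuallyEq ?_
  filter_upwards [(continuous_abs.tendsto t).eventually (gt_mem_nhds h1)] with s hs
  exact hval _ s hs

lemma exists_isFlow_of_lipschitzWith_of_bounded [CompleteSpace E] {V : E → E} {K L : ℝ≥0}
    (hV : LipschitzWith K V) (hL : ∀ x, ‖V x‖ ≤ L) : ∃ Φ : E → ℝ → E, IsFlow V Φ := by
  choose Φ hΦ0 hΦ using exists_isGlobalSolution_of_lipschitzWith_of_bounded hV hL
  refine ⟨Φ, ?_, hΦ0, hΦ, ?_⟩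
  · have hcont : ∀ t, Continuous fun x => Φ x t := by
      intro t
      refine (LipschitzWith.of_dist_le_mul (K := (Real.exp (K * |t|)).toNNReal)
        fun x y => ?_).continuous
      rw [Real.coe_toNNReal _ (Real.exp_pos _).le, mul_comm]
      simpa [hΦ0] using dist_le_of_isGlobalSolution hV (hΦ x) (hΦ y) t
    have := continuous_prod_of_continuous_lipschitzWith (fun z : ℝ × E => Φ z.2 z.1) L hcont
      (fun x => (hΦ x).lipschitzWith hL)
    exact this.comp continuous_swap
  · intro x γ h0 h
    funext t
    have := dist_le_of_isGlobalSolution hV h (hΦ x) t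
    rw [h0, hΦ0, dist_self, zero_mul] at this
    exact dist_le_zero.1 this

/-- A curve whose velocity stays within `C` of `w` stays within `C * |h|` of the chord with
slope `w`. -/
lemma dist_add_smul_le (c c' : ℝ → E) (w : E) {C h : ℝ} (hc : ∀ t, HasDerivAt c (c' t) t)
    (hC : ∀ t ∈ uIcc 0 h, ‖c' t - w‖ ≤ C) : dist (c 0 + h • w) (c h) ≤ C * |h| := by
  have := (convex_uIcc (0 : ℝ) h).norm_image_sub_le_of_norm_hasDerivWithin_le
    (f := fun t => c t - t • w) (f' := fun t => c' t - w) (C := C)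
    (fun t _ => ((hc t).sub (by simpa using (hasDerivAt_id t).smul_const w)).hasDerivWithinAt)
    hC left_mem_uIcc right_mem_uIcc
  rw [dist_comm, dist_eq_norm]
  rw [zero_smul, sub_zero, sub_zero, Real.norm_eq_abs] at this
  rwa [sub_add_eq_sub_sub_swap]

end LipschitzFlow

/-! ### Volume preservation for separable vector fields -/

section Separable

variable {E₁ E₂ : Type*} [NormedAddCommGroup E₁] [NormedSpace ℝ E₁]
  [NormedAddCommGroup E₂] [NormedSpace ℝ E₂]

/-- The separable vector field `ẋ = A y`, `ẏ = B x`. -/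
def separableField (A : E₂ → E₁) (B : E₁ → E₂) (z : E₁ × E₂) : E₁ × E₂ := (A z.2, B z.1)

/-- One step of size `h` of the symplectic Euler method for `ẋ = A y`, `ẏ = B x`: a composition of
two shears. -/
def symplecticEuler (A : E₂ → E₁) (B : E₁ → E₂) (h : ℝ) (z : E₁ × E₂) : E₁ × E₂ :=
  (z.1 + h • A z.2, z.2 + h • B (z.1 + h • A z.2))

variable {A : E₂ → E₁} {B : E₁ → E₂} {K L : ℝ≥0}

omit [NormedSpace ℝ E₁] [NormedSpace ℝ E₂] in
lemma separableField_lipschitzWith (hA : LipschitzWith K A) (hB : LipschitzWith K B) :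
    LipschitzWith K (separableField A B) := by
  have := (hA.comp (LipschitzWith.prod_snd (α := E₁))).prodMk
    (hB.comp (LipschitzWith.prod_fst (β := E₂)))
  simp only [mul_one, max_self] at this
  exact this

/-- Stability of one symplectic Euler step. -/
lemma dist_symplecticEuler_le (hA : LipschitzWith K A) (hB : LipschitzWith K B) (h : ℝ)
    (z w : E₁ × E₂) :
    dist (symplecticEuler A B h z) (symplecticEuler A B h w) ≤ (1 + K * |h|) ^ 2 * dist z w := by
  have hK : 0 ≤ K * |h| := by positivity
  have hd : 0 ≤ dist z w := dist_nonneg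
  have h1 : dist z.1 w.1 ≤ dist z w := le_max_left _ _
  have h2 : dist z.2 w.2 ≤ dist z w := le_max_right _ _
  have e1 : dist (z.1 + h • A z.2) (w.1 + h • A w.2) ≤ (1 + K * |h|) * dist z w := by
    refine (dist_add_add_le _ _ _ _).trans ?_
    rw [dist_smul₀, Real.norm_eq_abs]
    have := mul_le_mul_of_nonneg_left ((hA.dist_le_mul z.2 w.2).trans
      (mul_le_mul_of_nonneg_left h2 K.2)) (abs_nonneg h)
    linarith
  refine max_le ?_ ?_
  · refine e1.trans ?_
    gcongr
    nlinarith
  · refine (dist_add_add_le _ _ _ _).trans ?_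
    rw [dist_smul₀, Real.norm_eq_abs]
    have := mul_le_mul_of_nonneg_left ((hB.dist_le_mul _ _).trans
      (mul_le_mul_of_nonneg_left e1 K.2)) (abs_nonneg h)
    nlinarith [mul_nonneg hK hd]

/-- The local error of one symplectic Euler step is quadratic in the step size. -/
lemma dist_symplecticEuler_flow_le (hA : LipschitzWith K A) (hB : LipschitzWith K B)
    (hAL : ∀ y, ‖A y‖ ≤ L) (hBL : ∀ x, ‖B x‖ ≤ L) {γ : ℝ → E₁ × E₂}
    (hγ : IsGlobalSolution (separableField A B) γ) (h : ℝ) :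
    dist (symplecticEuler A B h (γ 0)) (γ h) ≤ 2 * K * L * h ^ 2 := by
  have hlip := hγ.lipschitzWith (fun z => max_le (hAL z.2) (hBL z.1))
  have hd1 : ∀ t, HasDerivAt (fun t => (γ t).1) (A (γ t).2) t := fun t =>
    (hasFDerivAt_fst.comp_hasDerivAt t (hγ t) :)
  have hd2 : ∀ t, HasDerivAt (fun t => (γ t).2) (B (γ t).1) t := fun t =>
    (hasFDerivAt_snd.comp_hasDerivAt t (hγ t) :)
  have hmem : ∀ t ∈ uIcc 0 h, |t| ≤ |h| := fun t ht => by
    simpa using abs_sub_left_of_mem_uIcc ht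
  have hl : ∀ t ∈ uIcc 0 h, dist (γ t) (γ 0) ≤ L * |h| := fun t ht => by
    refine (hlip.dist_le_mul t 0).trans ?_
    rw [Real.dist_0_eq_abs]
    exact mul_le_mul_of_nonneg_left (hmem t ht) L.2
  have hh : |h| * |h| = h ^ 2 := by rw [← sq, sq_abs]
  have hKL : (0 : ℝ) ≤ K * L := by positivity
  refine max_le ?_ ?_
  · refine (dist_add_smul_le (fun t => (γ t).1) _ (A (γ 0).2) (C := K * (L * |h|)) hd1 fun t ht => ?_).trans ?_
    · rw [← dist_eq_norm]
      refine (hA.dist_le_mul _ _).trans (mul_le_mul_of_nonneg_left ?_ K.2)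
      exact (le_max_right _ _).trans (hl t ht)
    · nlinarith [mul_nonneg hKL (sq_nonneg h)]
  · refine (dist_add_smul_le (fun t => (γ t).2) _ (B ((γ 0).1 + h • A (γ 0).2))
      (C := K * (2 * (L * |h|))) hd2
      fun t ht => ?_).trans ?_
    · rw [← dist_eq_norm]
      refine (hB.dist_le_mul _ _).trans (mul_le_mul_of_nonneg_left ?_ K.2)
      have e1 : dist (γ t).1 (γ 0).1 ≤ L * |h| := (le_max_left _ _).trans (hl t ht)
      have e2 : dist (γ 0).1 ((γ 0).1 + h • A (γ 0).2) ≤ L * |h| := by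
        rw [dist_self_add_right, norm_smul, Real.norm_eq_abs, mul_comm]
        exact mul_le_mul_of_nonneg_right (hAL _) (abs_nonneg h)
      linarith [dist_triangle (γ t).1 (γ 0).1 ((γ 0).1 + h • A (γ 0).2)]
    · nlinarith

/-- Convergence of the symplectic Euler method for bounded Lipschitz separable fields. -/
lemma tendsto_symplecticEuler_iterate (hA : LipschitzWith K A) (hB : LipschitzWith K B)
    (hAL : ∀ y, ‖A y‖ ≤ L) (hBL : ∀ x, ‖B x‖ ≤ L) {γ : ℝ → E₁ × E₂}
    (hγ : IsGlobalSolution (separableField A B) γ) (t : ℝ) :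
    Tendsto (fun n : ℕ => (symplecticEuler A B (t / (n + 1)))^[n + 1] (γ 0)) atTop (𝓝 (γ t)) := by
  rw [tendsto_iff_dist_tendsto_zero]
  set D : ℝ := 2 * K * L * t ^ 2 * Real.exp (2 * K * |t| + K ^ 2 * t ^ 2) with hD
  have hlim : Tendsto (fun n : ℕ => D / ((n : ℝ) + 1)) atTop (𝓝 0) :=
    (tendsto_natCast_atTop_atTop.atTop_add tendsto_const_nhds).const_div_atTop D
  refine squeeze_zero (fun _ => dist_nonneg) (fun n => ?_) hlim
  set h : ℝ := t / (n + 1) with hh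
  have hn : (0 : ℝ) < n + 1 := by positivity
  have hnh : (n + 1) * h = t := by rw [hh]; field_simp
  set u : ℕ → ℝ := fun k => dist ((symplecticEuler A B h)^[k] (γ 0)) (γ (k * h)) with hu
  have hrec : ∀ k ≥ 0, u (k + 1) ≤
      (1 + (2 * K * |h| + K ^ 2 * h ^ 2)) * u k + 2 * K * L * h ^ 2 := by
    intro k _
    have h1 := dist_symplecticEuler_le hA hB h ((symplecticEuler A B h)^[k] (γ 0)) (γ (k * h))
    have h2 := dist_symplecticEuler_flow_le hA hB hAL hBL (hγ.comp_add (k * h)) h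
    simp only [add_zero] at h2
    have h3 : (k : ℝ) * h + h = ((k + 1 : ℕ) : ℝ) * h := by push_cast; ring
    have h4 : (1 + K * |h|) ^ 2 = 1 + (2 * K * |h| + K ^ 2 * h ^ 2) := by
      rw [← sq_abs h]; ring
    rw [h3] at h2
    rw [h4] at h1
    simp only [hu, Function.iterate_succ_apply']
    exact (dist_triangle _ _ _).trans (add_le_add h1 h2)
  have hg := discrete_gronwall (n₀ := 0) (u := u) (b := fun _ => 2 * K * L * h ^ 2)
    (c := fun _ => 2 * K * |h| + K ^ 2 * h ^ 2) (by simp [hu]) hrec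
    (fun _ _ => by positivity) (fun _ _ => by positivity) (Nat.zero_le (n + 1))
  have hu0 : u 0 = 0 := by simp [hu]
  have hun : u (n + 1) = dist ((symplecticEuler A B h)^[n + 1] (γ 0)) (γ t) := by
    simp only [hu]; rw [← hnh]; push_cast; rfl
  rw [hun, hu0] at hg
  refine hg.trans ?_
  simp only [Finset.sum_const, Nat.Ico_zero_eq_range, Finset.card_range, nsmul_eq_mul, zero_add]
  push_cast
  have e1 : (n + 1 : ℝ) * (2 * K * L * h ^ 2) = 2 * K * L * t ^ 2 / (n + 1) := by
    rw [hh]; field_simp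
  have e2 : (n + 1 : ℝ) * (2 * K * |h| + K ^ 2 * h ^ 2) ≤ 2 * K * |t| + K ^ 2 * t ^ 2 := by
    have a1 : (n + 1 : ℝ) * |h| = |t| := by
      rw [hh, abs_div, abs_of_pos hn]; field_simp
    have a2 : (n + 1 : ℝ) * h ^ 2 ≤ t ^ 2 := by
      have : t ^ 2 = (n + 1) * ((n + 1) * h ^ 2) := by rw [← hnh]; ring
      rw [this]
      have : 0 ≤ (n + 1) * h ^ 2 := by positivity
      have hn0 : (0 : ℝ) ≤ n := n.cast_nonneg
      nlinarith
    calc (n + 1 : ℝ) * (2 * K * |h| + K ^ 2 * h ^ 2)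
        = 2 * K * ((n + 1) * |h|) + K ^ 2 * ((n + 1) * h ^ 2) := by ring
      _ ≤ _ := by rw [a1]; gcongr
  rw [e1, hD, mul_div_right_comm _ (Real.exp _)]
  have e3 : 0 ≤ 2 * K * L * t ^ 2 / ((n : ℝ) + 1) := by positivity
  exact mul_le_mul_of_nonneg_left (Real.exp_le_exp.2 e2) e3

variable [MeasurableSpace E₁] [BorelSpace E₁] [MeasurableSpace E₂] [BorelSpace E₂]
  [FiniteDimensional ℝ E₁] [FiniteDimensional ℝ E₂]

lemma measurePreserving_symplecticEuler (hA : Continuous A) (hB : Continuous B)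
    (μ₁ : Measure E₁) (μ₂ : Measure E₂) [μ₁.IsAddHaarMeasure] [μ₂.IsAddHaarMeasure] (h : ℝ) :
    MeasurePreserving (symplecticEuler A B h) (μ₁.prod μ₂) (μ₁.prod μ₂) := by
  have h1 : MeasurePreserving (fun z : E₁ × E₂ => (z.1, z.2 + h • B z.1))
      (μ₁.prod μ₂) (μ₁.prod μ₂) :=
    (MeasurePreserving.id μ₁).skew_product (g := fun x y => y + h • B x)
      (by unfold Function.uncurry; fun_prop)
      (ae_of_all _ fun x => map_add_right_eq_self μ₂ _)
  have h2 : MeasurePreserving (fun z : E₂ × E₁ => (z.1, z.2 + h • A z.1))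
      (μ₂.prod μ₁) (μ₂.prod μ₁) :=
    (MeasurePreserving.id μ₂).skew_product (g := fun x y => y + h • A x)
      (by unfold Function.uncurry; fun_prop)
      (ae_of_all _ fun x => map_add_right_eq_self μ₁ _)
  have h3 := h1.comp ((Measure.measurePreserving_swap (μ := μ₂) (ν := μ₁)).comp
    (h2.comp (Measure.measurePreserving_swap (μ := μ₁) (ν := μ₂))))
  exact h3

/-- If measure preserving maps converge pointwise to `T`, then preimages under `T` do not increase
the measure of open sets. -/
lemma measure_preimage_le_of_tendsto {X : Type*} [TopologicalSpace X] [MeasurableSpace X]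
    [OpensMeasurableSpace X] {μ : Measure X} {T : X → X} {Tn : ℕ → X → X}
    (hTn : ∀ n, MeasurePreserving (Tn n) μ μ)
    (hlim : ∀ x, Tendsto (fun n => Tn n x) atTop (𝓝 (T x))) {O : Set X} (hO : IsOpen O) :
    μ (T ⁻¹' O) ≤ μ O := by
  have hsub : T ⁻¹' O ⊆ ⋃ m, ⋂ n ≥ m, Tn n ⁻¹' O := by
    intro x hx
    obtain ⟨m, hm⟩ := eventually_atTop.1 ((hlim x).eventually (hO.mem_nhds hx))
    exact mem_iUnion.2 ⟨m, mem_iInter₂.2 hm⟩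
  have hmono : Monotone fun m => ⋂ n ≥ m, Tn n ⁻¹' O := fun a b hab =>
    biInter_subset_biInter_left fun n hn => le_trans hab hn
  refine (measure_mono hsub).trans ?_
  rw [hmono.measure_iUnion]
  refine iSup_le fun m => ?_
  rw [← (hTn m).measure_preimage hO.measurableSet.nullMeasurableSet]
  exact measure_mono (biInter_subset_of_mem (s := {n | n ≥ m}) (le_refl m))

/-- Liouville's theorem for bounded Lipschitz separable fields: the flow preserves the product of
Haar measures, because it is a limit of compositions of shears. -/
theorem measurePreserving_flow_separableField (hA : LipschitzWith K A) (hB : LipschitzWith K B)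
    (hAL : ∀ y, ‖A y‖ ≤ L) (hBL : ∀ x, ‖B x‖ ≤ L) {Φ : E₁ × E₂ → ℝ → E₁ × E₂}
    (hΦ : IsFlow (separableField A B) Φ) (μ₁ : Measure E₁) (μ₂ : Measure E₂)
    [μ₁.IsAddHaarMeasure] [μ₂.IsAddHaarMeasure] (t : ℝ) :
    MeasurePreserving (fun z => Φ z t) (μ₁.prod μ₂) (μ₁.prod μ₂) := by
  have hmeas : ∀ s, Measurable fun z => Φ z s := fun s =>
    (hΦ.continuous.comp (Continuous.prodMk_left s)).measurable
  have hopen : ∀ (s : ℝ) (O : Set (E₁ × E₂)), IsOpen O →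
      (μ₁.prod μ₂) ((fun z => Φ z s) ⁻¹' O) ≤ (μ₁.prod μ₂) O := by
    intro s O hO
    refine measure_preimage_le_of_tendsto
      (Tn := fun n => (symplecticEuler A B (s / (n + 1)))^[n + 1])
      (fun n => (measurePreserving_symplecticEuler hA.continuous hB.continuous μ₁ μ₂ _).iterate _)
      (fun z => ?_) hO
    have := tendsto_symplecticEuler_iterate hA hB hAL hBL (hΦ.solution z) s
    rwa [hΦ.initial] at this
  have hle : ∀ (s : ℝ) (S : Set (E₁ × E₂)),
      (μ₁.prod μ₂) ((fun z => Φ z s) ⁻¹' S) ≤ (μ₁.prod μ₂) S := by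
    intro s S
    rw [S.measure_eq_iInf_isOpen (μ₁.prod μ₂)]
    exact le_iInf₂ fun O hSO => le_iInf fun hO =>
      (measure_mono (preimage_mono hSO)).trans (hopen s O hO)
  refine ⟨hmeas t, Measure.ext fun S hS => ?_⟩
  rw [Measure.map_apply (hmeas t) hS]
  refine le_antisymm (hle t S) ?_
  -- the inverse of the time-`t` map is the time-`(-t)` map
  have hinv : (fun z => Φ z (-t)) ⁻¹' ((fun z => Φ z t) ⁻¹' S) = S := by
    ext z
    simp [hΦ.flow_flow, hΦ.initial]
  calc (μ₁.prod μ₂) S = (μ₁.prod μ₂) ((fun z => Φ z (-t)) ⁻¹' ((fun z => Φ z t) ⁻¹' S)) := by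
        rw [hinv]
    _ ≤ _ := hle (-t) _

end Separable

/-! ### Clamping a real function to a compact interval -/

/-- The nearest point of the interval `[a, b]`. -/
def clamp (a b s : ℝ) : ℝ := max a (min s b)

lemma clamp_mem {a b : ℝ} (h : a ≤ b) (s : ℝ) : clamp a b s ∈ Icc a b :=
  ⟨le_max_left _ _, max_le h (min_le_right _ _)⟩

lemma clamp_of_mem {a b s : ℝ} (hs : s ∈ Icc a b) : clamp a b s = s := by
  rw [clamp, min_eq_left hs.2, max_eq_right hs.1]

lemma monotone_clamp (a b : ℝ) : Monotone (clamp a b) := fun _ _ h =>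
  max_le_max le_rfl (min_le_min h le_rfl)

lemma lipschitzWith_clamp (a b : ℝ) : LipschitzWith 1 (clamp a b) :=
  (LipschitzWith.id.min_const b).const_max a

lemma exists_lipschitzWith_comp_clamp {G : ℝ → ℝ} {a b : ℝ} (h : a ≤ b) {K : ℝ≥0}
    (hG : LipschitzOnWith K G (Icc a b)) :
    ∃ C : ℝ≥0, LipschitzWith C (G ∘ clamp a b) ∧ ∀ s, |G (clamp a b s)| ≤ C := by
  have hlip : LipschitzWith K (G ∘ clamp a b) := fun x y => by
    refine (hG (clamp_mem h x) (clamp_mem h y)).trans ?_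
    gcongr
    simpa using lipschitzWith_clamp a b x y
  have hba : 0 ≤ b - a := sub_nonneg.2 h
  refine ⟨K + (|G a| + K * (b - a)).toNNReal, hlip.weaken le_self_add, fun s => ?_⟩
  have h1 := hG.dist_le_mul _ (clamp_mem h s) a ⟨le_rfl, h⟩
  have h2 : |clamp a b s - a| ≤ b - a := by
    rw [abs_of_nonneg (sub_nonneg.2 (clamp_mem h s).1)]
    linarith [(clamp_mem h s).2]
  rw [NNReal.coe_add, Real.coe_toNNReal _ (by positivity)]
  rw [Real.dist_eq, Real.dist_eq] at h1
  have h3 := abs_sub_abs_le_abs_sub (G (clamp a b s)) (G a)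
  have h4 := mul_le_mul_of_nonneg_left h2 K.coe_nonneg
  have h5 := K.coe_nonneg
  linarith

/-! ### The convex potential of an increasing function -/

/-- The primitive, vanishing at `s₀`, of `G - g₀`. -/
def potential (G : ℝ → ℝ) (g₀ s₀ s : ℝ) : ℝ := ∫ z in s₀..s, (G z - g₀)

lemma hasDerivAt_potential {G : ℝ → ℝ} {I : Set ℝ} (hI : IsOpen I) (hI' : I.OrdConnected)
    (hG : ContinuousOn G I) (g₀ : ℝ) {s₀ s : ℝ} (hs₀ : s₀ ∈ I) (hs : s ∈ I) :
    HasDerivAt (potential G g₀ s₀) (G s - g₀) s := by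
  have hc : ContinuousOn (fun z => G z - g₀) I := hG.sub continuousOn_const
  exact intervalIntegral.integral_hasDerivAt_right
    (hc.mono (hI'.uIcc_subset hs₀ hs)).intervalIntegrable
    (hc.stronglyMeasurableAtFilter hI s hs) (hc.continuousAt (hI.mem_nhds hs))

lemma potential_congr {G G' : ℝ → ℝ} {g₀ s₀ s : ℝ} (h : EqOn G G' (uIcc s₀ s)) :
    potential G g₀ s₀ s = potential G' g₀ s₀ s :=
  intervalIntegral.integral_congr fun z hz => by simp only [h hz]

lemma intervalIntegrable_sub_const {G : ℝ → ℝ} {I : Set ℝ} (hI' : I.OrdConnected)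
    (hG : MonotoneOn G I) (g₀ : ℝ) {a b : ℝ} (ha : a ∈ I) (hb : b ∈ I) :
    IntervalIntegrable (fun z => G z - g₀) volume a b :=
  (hG.mono (hI'.uIcc_subset ha hb)).intervalIntegrable.sub intervalIntegrable_const

lemma mul_sub_le_integral {G : ℝ → ℝ} {I : Set ℝ} (hI' : I.OrdConnected) (hG : MonotoneOn G I)
    (g₀ : ℝ) {a b : ℝ} (ha : a ∈ I) (hb : b ∈ I) (hab : a ≤ b) :
    (G a - g₀) * (b - a) ≤ ∫ z in a..b, (G z - g₀) := by
  have := intervalIntegral.integral_mono_on hab intervalIntegrable_const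
    (intervalIntegrable_sub_const hI' hG g₀ ha hb) (f := fun _ => G a - g₀)
    fun z hz => sub_le_sub_right (hG ha (hI'.out ha hb hz) hz.1) g₀
  rwa [intervalIntegral.integral_const, smul_eq_mul, mul_comm] at this

lemma integral_le_mul_sub {G : ℝ → ℝ} {I : Set ℝ} (hI' : I.OrdConnected) (hG : MonotoneOn G I)
    (g₀ : ℝ) {a b : ℝ} (ha : a ∈ I) (hb : b ∈ I) (hab : a ≤ b) :
    ∫ z in a..b, (G z - g₀) ≤ (G b - g₀) * (b - a) := by
  have := intervalIntegral.integral_mono_on hab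
    (intervalIntegrable_sub_const hI' hG g₀ ha hb) intervalIntegrable_const
    (g := fun _ => G b - g₀)
    fun z hz => sub_le_sub_right (hG (hI'.out ha hb hz) hb hz.2) g₀
  rwa [intervalIntegral.integral_const, smul_eq_mul, mul_comm (b - a)] at this

lemma potential_nonneg {G : ℝ → ℝ} {I : Set ℝ} (hI' : I.OrdConnected) (hG : MonotoneOn G I)
    {s₀ s : ℝ} (hs₀ : s₀ ∈ I) (hs : s ∈ I) : 0 ≤ potential G (G s₀) s₀ s := by
  rcases le_total s₀ s with h | h
  · simpa [potential] using mul_sub_le_integral hI' hG (G s₀) hs₀ hs h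
  · have := integral_le_mul_sub hI' hG (G s₀) hs hs₀ h
    rw [potential, intervalIntegral.integral_symm]
    simpa using this

/-- The potential of an increasing function grows at least linearly away from `s₀`, at a rate
which only depends on the values of the function at `s₀ - ε`, `s₀` and `s₀ + ε`. -/
lemma mul_sub_le_potential {G : ℝ → ℝ} {I : Set ℝ} (hI' : I.OrdConnected) (hG : MonotoneOn G I)
    {s₀ s δ ε : ℝ} (hs₀ : s₀ ∈ I) (hs : s ∈ I) (hε : 0 ≤ ε) (hδ : 0 ≤ δ)
    (hl : s₀ - ε ∈ I) (hr : s₀ + ε ∈ I)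
    (hδl : G (s₀ - ε) + δ ≤ G s₀) (hδr : G s₀ + δ ≤ G (s₀ + ε)) :
    δ * (|s - s₀| - ε) ≤ potential G (G s₀) s₀ s := by
  have hint := fun {a b : ℝ} (ha : a ∈ I) (hb : b ∈ I) =>
    intervalIntegrable_sub_const hI' hG (G s₀) ha hb
  rcases le_total |s - s₀| ε with h | h
  · exact (mul_nonpos_of_nonneg_of_nonpos hδ (sub_nonpos.2 h)).trans
      (potential_nonneg hI' hG hs₀ hs)
  rcases le_total s₀ s with h' | h'
  · rw [abs_of_nonneg (sub_nonneg.2 h')] at h ⊢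
    have h1 := mul_sub_le_integral hI' hG (G s₀) hs₀ hr (by linarith)
    have h2 := mul_sub_le_integral hI' hG (G s₀) hr hs (by linarith)
    rw [potential, ← intervalIntegral.integral_add_adjacent_intervals (hint hs₀ hr) (hint hr hs)]
    nlinarith
  · rw [abs_of_nonpos (sub_nonpos.2 h')] at h ⊢
    have h1 := integral_le_mul_sub hI' hG (G s₀) hl hs₀ (by linarith)
    have h2 := integral_le_mul_sub hI' hG (G s₀) hs hl (by linarith)
    rw [potential, intervalIntegral.integral_symm,
      ← intervalIntegral.integral_add_adjacent_intervals (hint hs hl) (hint hl hs₀)]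
    nlinarith

/-! ### Reparametrization by gradient ascent time -/

section AscentTime

/-- The time that the ascent equation `ż = f' z` needs to get from `0` to `θ`. -/
def ascentTime (f : ℝ → ℝ) (θ : ℝ) : ℝ := ∫ z in (0 : ℝ)..θ, (deriv f z)⁻¹

/-- The position of the solution of `ż = f' z` with `z 0 = 0`, as a function of the ascent time;
its values outside the range of `ascentTime f` are irrelevant. -/
def ascentPosition (f : ℝ → ℝ) : ℝ → ℝ := Function.invFun (ascentTime f)

/-- The value of `f` as a function of the ascent time. -/
def ascentValue (f : ℝ → ℝ) (s : ℝ) : ℝ := f (ascentPosition f s)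

variable {f : ℝ → ℝ}

lemma hasStrictDerivAt_ascentTime (hf : ContDiff ℝ 2 f) (hf' : ∀ x, deriv f x ≠ 0) (θ : ℝ) :
    HasStrictDerivAt (ascentTime f) (deriv f θ)⁻¹ θ := by
  have hc : Continuous fun z => (deriv f z)⁻¹ :=
    (hf.continuous_deriv (by norm_num)).inv₀ hf'
  exact intervalIntegral.integral_hasStrictDerivAt_right (hc.intervalIntegrable _ _)
    (hc.stronglyMeasurableAtFilter _ _) hc.continuousAt

lemma hasDerivAt_ascentTime (hf : ContDiff ℝ 2 f) (hf' : ∀ x, deriv f x ≠ 0) (θ : ℝ) :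
    HasDerivAt (ascentTime f) (deriv f θ)⁻¹ θ :=
  (hasStrictDerivAt_ascentTime hf hf' θ).hasDerivAt

lemma continuous_ascentTime (hf : ContDiff ℝ 2 f) (hf' : ∀ x, deriv f x ≠ 0) :
    Continuous (ascentTime f) :=
  continuous_iff_continuousAt.2 fun θ => (hasDerivAt_ascentTime hf hf' θ).continuousAt

lemma injective_ascentTime (hf : ContDiff ℝ 2 f) (hf' : ∀ x, deriv f x ≠ 0) :
    Function.Injective (ascentTime f) := by
  have key : ∀ a b, a < b → ascentTime f a ≠ ascentTime f b := by
    intro a b hab h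
    obtain ⟨c, -, hc⟩ := exists_hasDerivAt_eq_zero hab
      (continuous_ascentTime hf hf').continuousOn h
      fun x _ => hasDerivAt_ascentTime hf hf' x
    exact inv_ne_zero (hf' c) hc
  intro a b h
  by_contra hne
  rcases lt_or_gt_of_ne hne with h' | h'
  · exact key a b h' h
  · exact key b a h' h.symm

lemma isOpenEmbedding_ascentTime (hf : ContDiff ℝ 2 f) (hf' : ∀ x, deriv f x ≠ 0) :
    IsOpenEmbedding (ascentTime f) :=
  .of_continuous_injective_isOpenMap (continuous_ascentTime hf hf') (injective_ascentTime hf hf')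
    (isOpenMap_of_hasStrictDerivAt (hasStrictDerivAt_ascentTime hf hf')
      fun x => inv_ne_zero (hf' x))

lemma ordConnected_range_ascentTime (hf : ContDiff ℝ 2 f) (hf' : ∀ x, deriv f x ≠ 0) :
    (range (ascentTime f)).OrdConnected :=
  (isPreconnected_range (continuous_ascentTime hf hf')).ordConnected

lemma ascentPosition_ascentTime (hf : ContDiff ℝ 2 f) (hf' : ∀ x, deriv f x ≠ 0) (θ : ℝ) :
    ascentPosition f (ascentTime f θ) = θ :=
  Function.leftInverse_invFun (injective_ascentTime hf hf') θ

lemma ascentTime_ascentPosition {s : ℝ} (hs : s ∈ range (ascentTime f)) :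
    ascentTime f (ascentPosition f s) = s :=
  Function.invFun_eq hs

lemma ascentValue_ascentTime (hf : ContDiff ℝ 2 f) (hf' : ∀ x, deriv f x ≠ 0) (θ : ℝ) :
    ascentValue f (ascentTime f θ) = f θ := by
  rw [ascentValue, ascentPosition_ascentTime hf hf']

lemma hasDerivAt_ascentPosition (hf : ContDiff ℝ 2 f) (hf' : ∀ x, deriv f x ≠ 0) {s : ℝ}
    (hs : s ∈ range (ascentTime f)) :
    HasDerivAt (ascentPosition f) (deriv f (ascentPosition f s)) s := by
  have hemb := isOpenEmbedding_ascentTime hf hf'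
  have hcont : ContinuousAt (ascentPosition f) s := by
    obtain ⟨θ, rfl⟩ := hs
    rw [← hemb.continuousAt_iff]
    have : ascentPosition f ∘ ascentTime f = id := funext (ascentPosition_ascentTime hf hf')
    rw [this]
    exact continuousAt_id
  have := HasDerivAt.of_local_left_inverse hcont
    (hasDerivAt_ascentTime hf hf' (ascentPosition f s)) (inv_ne_zero (hf' _))
    (by filter_upwards [hemb.isOpen_range.mem_nhds hs] with y hy
        exact ascentTime_ascentPosition hy)
  rwa [inv_inv] at this

lemma hasDerivAt_ascentValue (hf : ContDiff ℝ 2 f) (hf' : ∀ x, deriv f x ≠ 0) {s : ℝ}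
    (hs : s ∈ range (ascentTime f)) :
    HasDerivAt (ascentValue f) (deriv f (ascentPosition f s) ^ 2) s := by
  rw [sq]
  exact ((hf.differentiable (by norm_num)) _).hasDerivAt.comp s
    (hasDerivAt_ascentPosition hf hf' hs)

lemma strictMonoOn_ascentValue (hf : ContDiff ℝ 2 f) (hf' : ∀ x, deriv f x ≠ 0) :
    StrictMonoOn (ascentValue f) (range (ascentTime f)) :=
  strictMonoOn_of_hasDerivWithinAt_pos (ordConnected_range_ascentTime hf hf').convex
    (fun _ hs => (hasDerivAt_ascentValue hf hf' hs).continuousAt.continuousWithinAt)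
    (fun _ hs => (hasDerivAt_ascentValue hf hf' (interior_subset hs)).hasDerivWithinAt)
    fun _ _ => sq_pos_of_ne_zero (hf' _)

lemma continuousOn_ascentValue (hf : ContDiff ℝ 2 f) (hf' : ∀ x, deriv f x ≠ 0) :
    ContinuousOn (ascentValue f) (range (ascentTime f)) :=
  fun _ hs => (hasDerivAt_ascentValue hf hf' hs).continuousAt.continuousWithinAt

lemma exists_lipschitzOnWith_ascentValue (hf : ContDiff ℝ 2 f) (hf' : ∀ x, deriv f x ≠ 0)
    {a b : ℝ} (h : Icc a b ⊆ range (ascentTime f)) :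
    ∃ K : ℝ≥0, LipschitzOnWith K (ascentValue f) (Icc a b) := by
  have hcont : ContinuousOn (fun s => deriv f (ascentPosition f s) ^ 2) (Icc a b) := by
    refine ContinuousOn.pow ?_ 2
    refine (hf.continuous_deriv (by norm_num)).comp_continuousOn fun s hs => ?_
    exact (hasDerivAt_ascentPosition hf hf' (h hs)).continuousAt.continuousWithinAt
  obtain ⟨C, hC⟩ := isCompact_Icc.exists_bound_of_continuousOn hcont
  refine ⟨C.toNNReal, (convex_Icc a b).lipschitzOnWith_of_nnnorm_hasDerivWithin_le
    (fun s hs => (hasDerivAt_ascentValue hf hf' (h hs)).hasDerivWithinAt) fun s hs => ?_⟩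
  exact NNReal.le_toNNReal_of_coe_le (hC s hs)

/-- If the ascent equation has global solutions, then the ascent time takes all values. -/
lemma surjective_ascentTime (hf : ContDiff ℝ 2 f) (hf' : ∀ x, deriv f x ≠ 0)
    (hglob : HasGlobalSolutions (deriv f)) : Function.Surjective (ascentTime f) := by
  obtain ⟨γ, -, hγ⟩ := hglob 0
  -- along a solution the ascent time increases with unit speed
  have hd : ∀ t, HasDerivAt (fun t => ascentTime f (γ t) - t) 0 t := fun t => by
    have := ((hasDerivAt_ascentTime hf hf' (γ t)).comp t (hγ t)).sub (hasDerivAt_id t)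
    rwa [inv_mul_cancel₀ (hf' _), sub_self] at this
  intro s
  have hconst := is_const_of_deriv_eq_zero (fun t => (hd t).differentiableAt)
    (fun t => (hd t).deriv)
  refine ⟨γ (s - ascentTime f (γ 0)), ?_⟩
  have := hconst (s - ascentTime f (γ 0)) 0
  linarith

/-- If `f' ≤ 1` for an increasing function `f`, then the ascent time takes all values. -/
lemma surjective_ascentTime_of_deriv_le_one (hf : ContDiff ℝ 2 f) (hf0 : ∀ x, 0 < deriv f x)
    (hf1 : ∀ x, deriv f x ≤ 1) : Function.Surjective (ascentTime f) := by
  have hf' : ∀ x, deriv f x ≠ 0 := fun x => (hf0 x).ne'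
  have hmono : Monotone fun x => ascentTime f x - x :=
    monotone_of_hasDerivAt_nonneg
      (fun x => (hasDerivAt_ascentTime hf hf' x).sub (hasDerivAt_id x))
      fun x => sub_nonneg.2 ((one_le_inv₀ (hf0 x)).2 (hf1 x))
  have h0 : ascentTime f 0 = 0 := by simp [ascentTime]
  refine (continuous_ascentTime hf hf').surjective ?_ ?_
  · refine tendsto_atTop_mono' atTop ?_ tendsto_id
    filter_upwards [eventually_ge_atTop 0] with x hx
    have := hmono hx
    simp only [h0, sub_self] at this
    simpa using this
  · refine tendsto_atBot_mono' atBot ?_ tendsto_id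
    filter_upwards [eventually_le_atBot 0] with x hx
    have := hmono hx
    simp only [h0, sub_self] at this
    simpa using this

end AscentTime

/-! ### Bounded Lipschitz maps -/

section BoundedLipschitz

/-- The map `f` is Lipschitz continuous and bounded, by one and the same constant. -/
def IsBoundedLipschitz {X E : Type*} [PseudoEMetricSpace X] [SeminormedAddCommGroup E]
    (f : X → E) : Prop :=
  ∃ K : ℝ≥0, LipschitzWith K f ∧ ∀ x, ‖f x‖ ≤ K

variable {X E : Type*} [PseudoEMetricSpace X] [SeminormedAddCommGroup E]

lemma isBoundedLipschitz_const (c : E) : IsBoundedLipschitz (fun _ : X => c) :=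
  ⟨‖c‖₊, (LipschitzWith.const c).weaken bot_le, fun _ => le_rfl⟩

lemma IsBoundedLipschitz.add {f g : X → E} (hf : IsBoundedLipschitz f)
    (hg : IsBoundedLipschitz g) : IsBoundedLipschitz (fun x => f x + g x) := by
  obtain ⟨K, h1, h2⟩ := hf
  obtain ⟨L, h3, h4⟩ := hg
  exact ⟨K + L, h1.add h3, fun x => (norm_add_le _ _).trans (add_le_add (h2 x) (h4 x))⟩

lemma IsBoundedLipschitz.const_mul {f : X → ℝ} (hf : IsBoundedLipschitz f) (c : ℝ) :
    IsBoundedLipschitz (fun x => c * f x) := by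
  obtain ⟨K, h1, h2⟩ := hf
  refine ⟨‖c‖₊ * K, (lipschitzWith_smul c).comp h1, fun x => ?_⟩
  rw [norm_mul]
  exact mul_le_mul_of_nonneg_left (h2 x) (norm_nonneg c)

lemma IsBoundedLipschitz.finset_sum {α : Type*} (s : Finset α) {f : α → X → E}
    (hf : ∀ i, IsBoundedLipschitz (f i)) : IsBoundedLipschitz (fun x => ∑ i ∈ s, f i x) := by
  classical
  induction s using Finset.induction_on with
  | empty => simpa using isBoundedLipschitz_const (X := X) (0 : E)
  | insert a s ha ih => simpa [Finset.sum_insert ha] using (hf a).add ih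

lemma IsBoundedLipschitz.pi {ι : Type*} [Fintype ι] {f : ι → X → ℝ}
    (hf : ∀ i, IsBoundedLipschitz (f i)) : IsBoundedLipschitz (fun x i => f i x) := by
  choose K h1 h2 using hf
  have hK : ∀ i, K i ≤ ∑ j, K j := fun i =>
    Finset.single_le_sum (f := K) (fun _ _ => bot_le) (Finset.mem_univ i)
  refine ⟨∑ i, K i, fun x y => ?_, fun x => ?_⟩
  · rw [edist_pi_le_iff]
    exact fun i => (h1 i).weaken (hK i) x y
  · rw [pi_norm_le_iff_of_nonneg (NNReal.coe_nonneg _)]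
    exact fun i => (h2 i x).trans (hK i)

lemma IsBoundedLipschitz.comp_eval {ι : Type*} [Fintype ι] {f : ℝ → E}
    (hf : IsBoundedLipschitz f) (i : ι) : IsBoundedLipschitz (fun x : ι → ℝ => f (x i)) := by
  obtain ⟨K, h1, h2⟩ := hf
  refine ⟨K, ?_, fun x => h2 _⟩
  have := h1.comp (LipschitzWith.eval (α := fun _ : ι => ℝ) i)
  rwa [mul_one] at this

end BoundedLipschitz

/-! ### Hidden bilinear games in separable coordinates -/

section Hidden

variable {ι κ : Type*} [Fintype ι] [Fintype κ]

/-- The vector field `x_i' = -∑ j, C i j * (G j (y j) - q j)`. -/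
def leftField (C : Matrix ι κ ℝ) (G : κ → ℝ → ℝ) (q : κ → ℝ) (y : κ → ℝ) : ι → ℝ :=
  fun i => -∑ j, C i j * (G j (y j) - q j)

/-- The vector field `y_j' = ∑ i, C i j * (F i (x i) - p i)`. -/
def rightField (C : Matrix ι κ ℝ) (F : ι → ℝ → ℝ) (p : ι → ℝ) (x : ι → ℝ) : κ → ℝ :=
  fun j => ∑ i, C i j * (F i (x i) - p i)

/-- Gradient descent-ascent for `∑ i j, C i j * (f i (θ i) - p i) * (g j (φ j) - q j)`, where all
parameters `θ i`, `φ j` are real numbers. -/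
def hiddenField (C : Matrix ι κ ℝ) (f : ι → ℝ → ℝ) (g : κ → ℝ → ℝ) (p : ι → ℝ) (q : κ → ℝ)
    (x : (ι → ℝ) × (κ → ℝ)) : (ι → ℝ) × (κ → ℝ) :=
  (fun i => leftField C g q x.2 i * deriv (f i) (x.1 i),
    fun j => rightField C f p x.1 j * deriv (g j) (x.2 j))

/-- Measuring each parameter by its ascent time. -/
def ascentCoord (f : ι → ℝ → ℝ) (g : κ → ℝ → ℝ) (x : (ι → ℝ) × (κ → ℝ)) : (ι → ℝ) × (κ → ℝ) :=
  (fun i => ascentTime (f i) (x.1 i), fun j => ascentTime (g j) (x.2 j))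

/-- The left inverse of `ascentCoord`. -/
def ascentCoordInv (f : ι → ℝ → ℝ) (g : κ → ℝ → ℝ) (y : (ι → ℝ) × (κ → ℝ)) :
    (ι → ℝ) × (κ → ℝ) :=
  (fun i => ascentPosition (f i) (y.1 i), fun j => ascentPosition (g j) (y.2 j))

/-- The hidden bilinear dynamics in the coordinates `ascentCoord f g`: a separable field. -/
def reducedField (C : Matrix ι κ ℝ) (f : ι → ℝ → ℝ) (g : κ → ℝ → ℝ) (p : ι → ℝ) (q : κ → ℝ) :
    (ι → ℝ) × (κ → ℝ) → (ι → ℝ) × (κ → ℝ) :=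
  separableField (leftField C (fun j => ascentValue (g j)) q)
    (rightField C (fun i => ascentValue (f i)) p)

/-- `reducedField` evaluated at the nearest point of the box `Icc a b`. -/
def clampedField (C : Matrix ι κ ℝ) (f : ι → ℝ → ℝ) (g : κ → ℝ → ℝ) (p : ι → ℝ) (q : κ → ℝ)
    (a b : (ι → ℝ) × (κ → ℝ)) : (ι → ℝ) × (κ → ℝ) → (ι → ℝ) × (κ → ℝ) :=
  separableField (leftField C (fun j => ascentValue (g j) ∘ clamp (a.2 j) (b.2 j)) q)
    (rightField C (fun i => ascentValue (f i) ∘ clamp (a.1 i) (b.1 i)) p)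

/-- `f` is a `C²` function without critical points that attains the value `p`. -/
structure IsRegularAt (f : ℝ → ℝ) (p : ℝ) : Prop where
  contDiff : ContDiff ℝ 2 f
  deriv_ne_zero : ∀ x, deriv f x ≠ 0
  mem_range : p ∈ range f

/-- The ascent time at which `f` takes the value `p`. -/
def ascentCenter (f : ℝ → ℝ) (p : ℝ) : ℝ := ascentTime f (Function.invFun f p)

lemma IsRegularAt.ascentValue_center {f : ℝ → ℝ} {p : ℝ} (h : IsRegularAt f p) :
    ascentValue f (ascentCenter f p) = p := by
  rw [ascentCenter, ascentValue_ascentTime h.contDiff h.deriv_ne_zero]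
  exact Function.invFun_eq h.mem_range

lemma ascentCenter_mem_range (f : ℝ → ℝ) (p : ℝ) : ascentCenter f p ∈ range (ascentTime f) :=
  mem_range_self _

lemma leftField_isBoundedLipschitz (C : Matrix ι κ ℝ) {G : κ → ℝ → ℝ} (q : κ → ℝ)
    (hG : ∀ j, IsBoundedLipschitz (G j)) : IsBoundedLipschitz (leftField C G q) := by
  refine IsBoundedLipschitz.pi fun i => ?_
  have := (IsBoundedLipschitz.finset_sum Finset.univ fun j =>
    (((hG j).comp_eval j).add (isBoundedLipschitz_const (-q j))).const_mul (C i j)).const_mul (-1)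
  simp only [neg_one_mul, ← sub_eq_add_neg] at this
  exact this

lemma rightField_isBoundedLipschitz (C : Matrix ι κ ℝ) {F : ι → ℝ → ℝ} (p : ι → ℝ)
    (hF : ∀ i, IsBoundedLipschitz (F i)) : IsBoundedLipschitz (rightField C F p) := by
  refine IsBoundedLipschitz.pi fun j => ?_
  have := IsBoundedLipschitz.finset_sum Finset.univ fun i =>
    (((hF i).comp_eval i).add (isBoundedLipschitz_const (-p i))).const_mul (C i j)
  simp only [← sub_eq_add_neg] at this
  exact this

lemma isBoundedLipschitz_ascentValue_clamp {f : ℝ → ℝ} {p a b : ℝ} (h : IsRegularAt f p)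
    (hab : a ≤ b) (hI : Icc a b ⊆ range (ascentTime f)) :
    IsBoundedLipschitz (ascentValue f ∘ clamp a b) := by
  obtain ⟨K, hK⟩ := exists_lipschitzOnWith_ascentValue h.contDiff h.deriv_ne_zero hI
  exact exists_lipschitzWith_comp_clamp hab hK

/-- A curve in a product of real vector spaces is differentiated coordinatewise. -/
lemma hasDerivAt_coord_iff {γ : ℝ → (ι → ℝ) × (κ → ℝ)} {w : (ι → ℝ) × (κ → ℝ)} {t : ℝ} :
    HasDerivAt γ w t ↔ (∀ i, HasDerivAt (fun t => (γ t).1 i) (w.1 i) t) ∧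
      ∀ j, HasDerivAt (fun t => (γ t).2 j) (w.2 j) t := by
  rw [← hasDerivAt_pi, ← hasDerivAt_pi]
  exact ⟨fun h => ⟨(hasFDerivAt_fst.comp_hasDerivAt t h :), (hasFDerivAt_snd.comp_hasDerivAt t h :)⟩,
    fun h => h.1.prodMk h.2⟩

variable {C : Matrix ι κ ℝ} {f : ι → ℝ → ℝ} {g : κ → ℝ → ℝ} {p : ι → ℝ} {q : κ → ℝ}

/-- `Icc a b` is a nonempty box of ascent coordinates. -/
structure IsAscentBox (f : ι → ℝ → ℝ) (g : κ → ℝ → ℝ) (a b : (ι → ℝ) × (κ → ℝ)) : Prop where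
  left_le : ∀ i, a.1 i ≤ b.1 i
  right_le : ∀ j, a.2 j ≤ b.2 j
  left_subset : ∀ i, Icc (a.1 i) (b.1 i) ⊆ range (ascentTime (f i))
  right_subset : ∀ j, Icc (a.2 j) (b.2 j) ⊆ range (ascentTime (g j))

omit [Fintype ι] [Fintype κ] in
lemma mem_Icc_coord {a b y : (ι → ℝ) × (κ → ℝ)} : y ∈ Icc a b ↔
    (∀ i, y.1 i ∈ Icc (a.1 i) (b.1 i)) ∧ ∀ j, y.2 j ∈ Icc (a.2 j) (b.2 j) := by
  simp only [mem_Icc, Prod.le_def, Pi.le_def, forall_and]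
  tauto

lemma clampedField_eq {a b y : (ι → ℝ) × (κ → ℝ)} (hy : y ∈ Icc a b) :
    clampedField C f g p q a b y = reducedField C f g p q y := by
  rw [mem_Icc_coord] at hy
  refine Prod.ext (funext fun i => ?_) (funext fun j => ?_)
  · simp only [clampedField, reducedField, separableField, leftField,
      Function.comp_apply, clamp_of_mem (hy.2 _)]
  · simp only [clampedField, reducedField, separableField, rightField,
      Function.comp_apply, clamp_of_mem (hy.1 _)]

/-- The clamped field has a global flow, and this flow preserves the volume. -/
lemma exists_clamped_flow (C : Matrix ι κ ℝ) (hf : ∀ i, IsRegularAt (f i) (p i))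
    (hg : ∀ j, IsRegularAt (g j) (q j)) {a b : (ι → ℝ) × (κ → ℝ)} (hab : IsAscentBox f g a b) :
    ∃ (K : ℝ≥0) (Ψ : (ι → ℝ) × (κ → ℝ) → ℝ → (ι → ℝ) × (κ → ℝ)),
      LipschitzWith K (clampedField C f g p q a b) ∧ IsFlow (clampedField C f g p q a b) Ψ ∧
      ∀ t, MeasurePreserving (fun y => Ψ y t) volume volume := by
  obtain ⟨K₁, h1, h2⟩ := leftField_isBoundedLipschitz C q fun j =>
    isBoundedLipschitz_ascentValue_clamp (hg j) (hab.right_le j) (hab.right_subset j)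
  obtain ⟨K₂, h3, h4⟩ := rightField_isBoundedLipschitz C p fun i =>
    isBoundedLipschitz_ascentValue_clamp (hf i) (hab.left_le i) (hab.left_subset i)
  have h1' := h1.weaken (le_max_left K₁ K₂)
  have h3' := h3.weaken (le_max_right K₁ K₂)
  have h2' := fun y => (h2 y).trans (NNReal.coe_le_coe.2 (le_max_left K₁ K₂))
  have h4' := fun x => (h4 x).trans (NNReal.coe_le_coe.2 (le_max_right K₁ K₂))
  have hlip := separableField_lipschitzWith h1' h3'
  obtain ⟨Ψ, hΨ⟩ := exists_isFlow_of_lipschitzWith_of_bounded hlip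
    (fun z => max_le (h2' z.2) (h4' z.1))
  exact ⟨_, Ψ, hlip, hΨ, fun t =>
    measurePreserving_flow_separableField h1' h3' h2' h4' hΨ volume volume t⟩

lemma hasDerivAt_ascentCoord_comp (hf : ∀ i, IsRegularAt (f i) (p i))
    (hg : ∀ j, IsRegularAt (g j) (q j)) {γ : ℝ → (ι → ℝ) × (κ → ℝ)} {t : ℝ}
    (hγ : HasDerivAt γ (hiddenField C f g p q (γ t)) t) :
    HasDerivAt (fun t => ascentCoord f g (γ t))
      (reducedField C f g p q (ascentCoord f g (γ t))) t := by
  rw [hasDerivAt_coord_iff] at hγ ⊢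
  refine ⟨fun i => ?_, fun j => ?_⟩
  · have := (hasDerivAt_ascentTime (hf i).contDiff (hf i).deriv_ne_zero _).comp t (hγ.1 i)
    refine this.congr_deriv ?_
    simp only [reducedField, separableField, leftField, ascentCoord, hiddenField,
      ascentValue_ascentTime (hg _).contDiff (hg _).deriv_ne_zero]
    rw [mul_comm, mul_assoc, mul_inv_cancel₀ ((hf i).deriv_ne_zero _), mul_one]
  · have := (hasDerivAt_ascentTime (hg j).contDiff (hg j).deriv_ne_zero _).comp t (hγ.2 j)
    refine this.congr_deriv ?_
    simp only [reducedField, separableField, rightField, ascentCoord, hiddenField,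
      ascentValue_ascentTime (hf _).contDiff (hf _).deriv_ne_zero]
    rw [mul_comm, mul_assoc, mul_inv_cancel₀ ((hg j).deriv_ne_zero _), mul_one]

omit [Fintype ι] [Fintype κ] in
lemma mem_range_ascentCoord {y : (ι → ℝ) × (κ → ℝ)} :
    y ∈ range (ascentCoord f g) ↔ (∀ i, y.1 i ∈ range (ascentTime (f i))) ∧
      ∀ j, y.2 j ∈ range (ascentTime (g j)) := by
  constructor
  · rintro ⟨x, rfl⟩
    exact ⟨fun i => mem_range_self _, fun j => mem_range_self _⟩
  · rintro ⟨h1, h2⟩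
    choose θ hθ using h1
    choose φ hφ using h2
    exact ⟨(θ, φ), Prod.ext (funext hθ) (funext hφ)⟩

lemma hasDerivAt_ascentCoordInv_comp (hf : ∀ i, IsRegularAt (f i) (p i))
    (hg : ∀ j, IsRegularAt (g j) (q j)) {y : ℝ → (ι → ℝ) × (κ → ℝ)} {t : ℝ}
    (hy : HasDerivAt y (reducedField C f g p q (y t)) t) (hmem : y t ∈ range (ascentCoord f g)) :
    HasDerivAt (fun t => ascentCoordInv f g (y t))
      (hiddenField C f g p q (ascentCoordInv f g (y t))) t := by
  rw [hasDerivAt_coord_iff] at hy ⊢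
  rw [mem_range_ascentCoord] at hmem
  refine ⟨fun i => ?_, fun j => ?_⟩
  · have := (hasDerivAt_ascentPosition (hf i).contDiff (hf i).deriv_ne_zero (hmem.1 i)).comp t
      (hy.1 i)
    exact this.congr_deriv (mul_comm _ _)
  · have := (hasDerivAt_ascentPosition (hg j).contDiff (hg j).deriv_ne_zero (hmem.2 j)).comp t
      (hy.2 j)
    exact this.congr_deriv (mul_comm _ _)

omit [Fintype ι] [Fintype κ] in
lemma ascentCoordInv_ascentCoord (hf : ∀ i, IsRegularAt (f i) (p i))
    (hg : ∀ j, IsRegularAt (g j) (q j)) (x : (ι → ℝ) × (κ → ℝ)) :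
    ascentCoordInv f g (ascentCoord f g x) = x :=
  Prod.ext (funext fun i => ascentPosition_ascentTime (hf i).contDiff (hf i).deriv_ne_zero _)
    (funext fun j => ascentPosition_ascentTime (hg j).contDiff (hg j).deriv_ne_zero _)

/-! ### The conserved energy -/

/-- The energy for coordinate functions `F`, `G` with values `p`, `q` at the center `z₀`. -/
def energy (F : ι → ℝ → ℝ) (G : κ → ℝ → ℝ) (p : ι → ℝ) (q : κ → ℝ) (z₀ y : (ι → ℝ) × (κ → ℝ)) :
    ℝ :=
  ∑ i, potential (F i) (p i) (z₀.1 i) (y.1 i) + ∑ j, potential (G j) (q j) (z₀.2 j) (y.2 j)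

/-- The energy is conserved since the two players' contributions to its derivative are
`∓ ∑ i j, C i j * (F i - p i) * (G j - q j)`. -/
lemma hasDerivAt_energy {F : ι → ℝ → ℝ} {G : κ → ℝ → ℝ} {z₀ : (ι → ℝ) × (κ → ℝ)}
    {y : ℝ → (ι → ℝ) × (κ → ℝ)} {t : ℝ}
    (hy : HasDerivAt y (separableField (leftField C G q) (rightField C F p) (y t)) t)
    (hF : ∀ i, HasDerivAt (potential (F i) (p i) (z₀.1 i)) (F i ((y t).1 i) - p i) ((y t).1 i))
    (hG : ∀ j, HasDerivAt (potential (G j) (q j) (z₀.2 j)) (G j ((y t).2 j) - q j) ((y t).2 j)) :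
    HasDerivAt (fun t => energy F G p q z₀ (y t)) 0 t := by
  rw [hasDerivAt_coord_iff] at hy
  have h1 := HasDerivAt.fun_sum (u := Finset.univ) fun i _ => (hF i).comp t (hy.1 i)
  have h2 := HasDerivAt.fun_sum (u := Finset.univ) fun j _ => (hG j).comp t (hy.2 j)
  refine (h1.add h2).congr_deriv ?_
  simp only [separableField, leftField, rightField, mul_neg, Finset.sum_neg_distrib,
    Finset.mul_sum]
  rw [Finset.sum_comm, neg_add_eq_sub, sub_eq_zero]
  exact Finset.sum_congr rfl fun j _ => Finset.sum_congr rfl fun i _ => by ring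

lemma potential_le_energy {F : ι → ℝ → ℝ} {G : κ → ℝ → ℝ} {z₀ y : (ι → ℝ) × (κ → ℝ)}
    (hF : ∀ i, 0 ≤ potential (F i) (p i) (z₀.1 i) (y.1 i))
    (hG : ∀ j, 0 ≤ potential (G j) (q j) (z₀.2 j) (y.2 j)) :
    (∀ i, potential (F i) (p i) (z₀.1 i) (y.1 i) ≤ energy F G p q z₀ y) ∧
      ∀ j, potential (G j) (q j) (z₀.2 j) (y.2 j) ≤ energy F G p q z₀ y := by
  have h1 := Finset.sum_nonneg fun i (_ : i ∈ Finset.univ) => hF i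
  have h2 := Finset.sum_nonneg fun j (_ : j ∈ Finset.univ) => hG j
  constructor
  · intro i
    have := Finset.single_le_sum (fun i _ => hF i) (Finset.mem_univ i)
    unfold energy
    linarith
  · intro j
    have := Finset.single_le_sum (fun j _ => hG j) (Finset.mem_univ j)
    unfold energy
    linarith

end Hidden

/-! ### Global solutions when all ascent trajectories are global -/

section Existence

variable {ι κ : Type*} [Fintype ι] [Fintype κ]
  {C : Matrix ι κ ℝ} {f : ι → ℝ → ℝ} {g : κ → ℝ → ℝ} {p : ι → ℝ} {q : κ → ℝ}

lemma IsRegularAt.monotone_clamp {f : ℝ → ℝ} {p a b : ℝ} (h : IsRegularAt f p) (hab : a ≤ b)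
    (hI : Icc a b ⊆ range (ascentTime f)) : Monotone (ascentValue f ∘ clamp a b) := fun s t hst =>
  (strictMonoOn_ascentValue h.contDiff h.deriv_ne_zero).monotoneOn (hI (clamp_mem hab s))
    (hI (clamp_mem hab t)) (HiddenBilinear.monotone_clamp a b hst)

/-- Around the center there is a margin `ε` of ascent time on which the value of `f` moves away
from `p` by some `δ > 0` in both directions. -/
lemma IsRegularAt.exists_margin {f : ℝ → ℝ} {p : ℝ} (h : IsRegularAt f p) :
    ∃ ε > 0, ∃ δ > 0, ascentCenter f p - ε ∈ range (ascentTime f) ∧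
      ascentCenter f p + ε ∈ range (ascentTime f) ∧
      ascentValue f (ascentCenter f p - ε) + δ ≤ p ∧
      p + δ ≤ ascentValue f (ascentCenter f p + ε) := by
  have hmono := strictMonoOn_ascentValue h.contDiff h.deriv_ne_zero
  have hopen := (isOpenEmbedding_ascentTime h.contDiff h.deriv_ne_zero).isOpen_range
  have hc := ascentCenter_mem_range f p
  obtain ⟨ε, hε, hball⟩ := Metric.isOpen_iff.1 hopen _ hc
  have hl : ascentCenter f p - ε / 2 ∈ range (ascentTime f) := hball (by
    rw [Real.ball_eq_Ioo]; constructor <;> linarith)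
  have hr : ascentCenter f p + ε / 2 ∈ range (ascentTime f) := hball (by
    rw [Real.ball_eq_Ioo]; constructor <;> linarith)
  have h1 := hmono hl hc (by linarith)
  have h2 := hmono hc hr (by linarith)
  rw [h.ascentValue_center] at h1 h2
  refine ⟨ε / 2, by positivity, min (p - ascentValue f (ascentCenter f p - ε / 2))
    (ascentValue f (ascentCenter f p + ε / 2) - p), lt_min (by linarith) (by linarith), hl, hr,
    ?_, ?_⟩
  · linarith [min_le_left (p - ascentValue f (ascentCenter f p - ε / 2))
      (ascentValue f (ascentCenter f p + ε / 2) - p)]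
  · linarith [min_le_right (p - ascentValue f (ascentCenter f p - ε / 2))
      (ascentValue f (ascentCenter f p + ε / 2) - p)]

/-- The potential controls the distance of the ascent time from the center. -/
lemma IsRegularAt.exists_coercive {f : ℝ → ℝ} {p : ℝ} (h : IsRegularAt f p) :
    ∃ ε > 0, ∃ δ > 0, ∀ s ∈ range (ascentTime f),
      δ * (|s - ascentCenter f p| - ε) ≤ potential (ascentValue f) p (ascentCenter f p) s := by
  obtain ⟨ε, hε, δ, hδ, hl, hr, h1, h2⟩ := h.exists_margin
  refine ⟨ε, hε, δ, hδ, fun s hs => ?_⟩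
  have := mul_sub_le_potential (ordConnected_range_ascentTime h.contDiff h.deriv_ne_zero)
    (strictMonoOn_ascentValue h.contDiff h.deriv_ne_zero).monotoneOn
    (ascentCenter_mem_range f p) hs hε.le hδ.le hl hr
    (by rwa [h.ascentValue_center]) (by rwa [h.ascentValue_center])
  rwa [h.ascentValue_center] at this

lemma IsRegularAt.potential_nonneg {f : ℝ → ℝ} {p s : ℝ} (h : IsRegularAt f p)
    (hs : s ∈ range (ascentTime f)) :
    0 ≤ potential (ascentValue f) p (ascentCenter f p) s := by
  have := HiddenBilinear.potential_nonneg
    (ordConnected_range_ascentTime h.contDiff h.deriv_ne_zero)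
    (strictMonoOn_ascentValue h.contDiff h.deriv_ne_zero).monotoneOn
    (ascentCenter_mem_range f p) hs
  rwa [h.ascentValue_center] at this

/-- If the ascent time takes all values, then for each energy level `e` and ascent time `y₀` there
is a box around the center, of half-width `R`, that contains `y₀` and whose clamped potential
exceeds `e` outside of it. -/
lemma IsRegularAt.exists_radius {f : ℝ → ℝ} {p : ℝ} (h : IsRegularAt f p)
    (hsurj : Function.Surjective (ascentTime f)) (e y₀ : ℝ) :
    ∃ R ≥ 0, y₀ ∈ Icc (ascentCenter f p - R) (ascentCenter f p + R) ∧
      ∀ s, 0 ≤ potential (ascentValue f ∘ clamp (ascentCenter f p - R) (ascentCenter f p + R)) p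
          (ascentCenter f p) s ∧
        (potential (ascentValue f ∘ clamp (ascentCenter f p - R) (ascentCenter f p + R)) p
          (ascentCenter f p) s ≤ e → s ∈ Icc (ascentCenter f p - R) (ascentCenter f p + R)) := by
  obtain ⟨ε, hε, δ, hδ, -, -, h1, h2⟩ := h.exists_margin
  set c := ascentCenter f p with hc
  set R := ε + |e| / δ + |y₀ - c| with hR
  have hR0 : 0 ≤ |e| / δ := by positivity
  have hεR : ε ≤ R := by have := abs_nonneg (y₀ - c); linarith
  have hRnn : 0 ≤ R := hε.le.trans hεR
  have hval : ∀ s, |s - c| ≤ R → s ∈ Icc (c - R) (c + R) := fun s hs => by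
    have := abs_le.1 hs
    constructor <;> linarith
  set G := ascentValue f ∘ clamp (c - R) (c + R) with hG
  have hGval : ∀ s, |s - c| ≤ R → G s = ascentValue f s := fun s hs => by
    simp only [hG, Function.comp_apply, clamp_of_mem (hval s hs)]
  have hGmono : MonotoneOn G univ :=
    (h.monotone_clamp (by linarith) (by simp [hsurj.range_eq])).monotoneOn _
  have hGc : G c = p := by
    rw [hGval c (by simpa using hRnn), hc, h.ascentValue_center]
  have hl : G (c - ε) = ascentValue f (c - ε) := hGval _ (by
    rwa [sub_sub_cancel_left, abs_neg, abs_of_pos hε])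
  have hr : G (c + ε) = ascentValue f (c + ε) := hGval _ (by
    rwa [add_sub_cancel_left, abs_of_pos hε])
  refine ⟨R, hRnn, hval _ (by linarith), fun s => ⟨?_, fun hs => hval _ ?_⟩⟩
  · rw [← hGc]
    exact HiddenBilinear.potential_nonneg ordConnected_univ hGmono trivial trivial
  · have := mul_sub_le_potential (s := s) ordConnected_univ hGmono (mem_univ c) trivial hε.le hδ.le
      trivial trivial (by rw [hl, hGc]; exact h1) (by rw [hr, hGc]; exact h2)
    rw [hGc] at this
    have h3 : δ * (|s - c| - ε) ≤ |e| := (this.trans hs).trans (le_abs_self e)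
    rw [mul_comm, ← le_div_iff₀ hδ] at h3
    have := abs_nonneg (y₀ - c)
    linarith

/-- The center of the energy, in ascent coordinates. -/
def centerCoord (f : ι → ℝ → ℝ) (g : κ → ℝ → ℝ) (p : ι → ℝ) (q : κ → ℝ) :
    (ι → ℝ) × (κ → ℝ) :=
  (fun i => ascentCenter (f i) (p i), fun j => ascentCenter (g j) (q j))

/-- If all ascent times take all values, then the energy confines each solution of the reduced
system to a box, so all solutions are global. -/
theorem hasGlobalSolutions_hiddenField (C : Matrix ι κ ℝ) (hf : ∀ i, IsRegularAt (f i) (p i))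
    (hg : ∀ j, IsRegularAt (g j) (q j)) (hfs : ∀ i, Function.Surjective (ascentTime (f i)))
    (hgs : ∀ j, Function.Surjective (ascentTime (g j))) :
    HasGlobalSolutions (hiddenField C f g p q) := by
  intro x₀
  set y₀ := ascentCoord f g x₀ with hy₀
  set z₀ := centerCoord f g p q with hz₀
  set e := energy (fun i => ascentValue (f i)) (fun j => ascentValue (g j)) p q z₀ y₀ with he
  choose R hR hRy hRe using fun i => (hf i).exists_radius (hfs i) e (y₀.1 i)
  choose S hS hSy hSe using fun j => (hg j).exists_radius (hgs j) e (y₀.2 j)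
  set a : (ι → ℝ) × (κ → ℝ) := (fun i => z₀.1 i - R i, fun j => z₀.2 j - S j) with ha
  set b : (ι → ℝ) × (κ → ℝ) := (fun i => z₀.1 i + R i, fun j => z₀.2 j + S j) with hb
  have hbox : IsAscentBox f g a b :=
    { left_le := fun i => by have := hR i; simp only [ha, hb]; linarith
      right_le := fun j => by have := hS j; simp only [ha, hb]; linarith
      left_subset := fun i => by simp [(hfs i).range_eq]
      right_subset := fun j => by simp [(hgs j).range_eq] }
  obtain ⟨K, Ψ, hlip, hΨ, -⟩ := exists_clamped_flow C hf hg hbox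
  have hFcont : ∀ i, Continuous (ascentValue (f i) ∘ clamp (a.1 i) (b.1 i)) := fun i => by
    obtain ⟨K, hK, -⟩ := isBoundedLipschitz_ascentValue_clamp (hf i) (hbox.left_le i)
      (hbox.left_subset i)
    exact hK.continuous
  have hGcont : ∀ j, Continuous (ascentValue (g j) ∘ clamp (a.2 j) (b.2 j)) := fun j => by
    obtain ⟨K, hK, -⟩ := isBoundedLipschitz_ascentValue_clamp (hg j) (hbox.right_le j)
      (hbox.right_subset j)
    exact hK.continuous
  set ec := energy (fun i => ascentValue (f i) ∘ clamp (a.1 i) (b.1 i))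
    (fun j => ascentValue (g j) ∘ clamp (a.2 j) (b.2 j)) p q z₀ with hec
  have hd : ∀ t, HasDerivAt (fun t => ec (Ψ y₀ t)) 0 t := fun t =>
    hasDerivAt_energy (hΨ.solution y₀ t)
      (fun i => hasDerivAt_potential isOpen_univ ordConnected_univ (hFcont i).continuousOn _
        trivial trivial)
      (fun j => hasDerivAt_potential isOpen_univ ordConnected_univ (hGcont j).continuousOn _
        trivial trivial)
  have hconst : ∀ t, ec (Ψ y₀ t) = e := fun t => by
    have h1 := is_const_of_deriv_eq_zero (fun t => (hd t).differentiableAt)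
      (fun t => (hd t).deriv) t 0
    refine h1.trans ?_
    -- the segments from the center to `y₀` lie in the box, where clamping has no effect
    rw [hΨ.initial, hec, he, energy, energy]
    congr 1
    · refine Finset.sum_congr rfl fun i _ => potential_congr fun s hs => ?_
      have hc : z₀.1 i ∈ Icc (a.1 i) (b.1 i) := by
        have := hR i; simp only [ha, hb]; constructor <;> linarith
      simp only [Function.comp_apply, clamp_of_mem (ordConnected_Icc.uIcc_subset hc (hRy i) hs)]
    · refine Finset.sum_congr rfl fun j _ => potential_congr fun s hs => ?_
      have hc : z₀.2 j ∈ Icc (a.2 j) (b.2 j) := by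
        have := hS j; simp only [ha, hb]; constructor <;> linarith
      simp only [Function.comp_apply, clamp_of_mem (ordConnected_Icc.uIcc_subset hc (hSy j) hs)]
  have hmem : ∀ t, Ψ y₀ t ∈ Icc a b := fun t => by
    obtain ⟨h1, h2⟩ := potential_le_energy (z₀ := z₀) (y := Ψ y₀ t)
      (fun i => (hRe i ((Ψ y₀ t).1 i)).1) (fun j => (hSe j ((Ψ y₀ t).2 j)).1)
    exact mem_Icc_coord.2 ⟨fun i => (hRe i _).2 ((h1 i).trans (hconst t).le),
      fun j => (hSe j _).2 ((h2 j).trans (hconst t).le)⟩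
  refine ⟨fun t => ascentCoordInv f g (Ψ y₀ t), ?_, fun t => ?_⟩
  · simp only [hΨ.initial]
    exact ascentCoordInv_ascentCoord hf hg x₀
  · refine hasDerivAt_ascentCoordInv_comp hf hg ?_
      (mem_range_ascentCoord.2 ⟨fun i => hfs i _, fun j => hgs j _⟩)
    have := hΨ.solution y₀ t
    rwa [clampedField_eq (hmem t)] at this

end Existence

/-! ### The flow in the original coordinates -/

section FlowExists

variable {ι κ : Type*} [Fintype ι] [Fintype κ]
  {C : Matrix ι κ ℝ} {f : ι → ℝ → ℝ} {g : κ → ℝ → ℝ} {p : ι → ℝ} {q : κ → ℝ}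

omit [Fintype ι] [Fintype κ] in
lemma continuous_ascentCoord (hf : ∀ i, IsRegularAt (f i) (p i))
    (hg : ∀ j, IsRegularAt (g j) (q j)) : Continuous (ascentCoord f g) := by
  refine Continuous.prodMk (continuous_pi fun i => ?_) (continuous_pi fun j => ?_)
  · exact (continuous_ascentTime (hf i).contDiff (hf i).deriv_ne_zero).comp
      ((continuous_apply i).comp continuous_fst)
  · exact (continuous_ascentTime (hg j).contDiff (hg j).deriv_ne_zero).comp
      ((continuous_apply j).comp continuous_snd)

omit [Fintype ι] [Fintype κ] in
lemma injective_ascentCoord (hf : ∀ i, IsRegularAt (f i) (p i))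
    (hg : ∀ j, IsRegularAt (g j) (q j)) : Function.Injective (ascentCoord f g) :=
  Function.LeftInverse.injective (ascentCoordInv_ascentCoord hf hg)

lemma differentiableAt_ascentCoordInv (hf : ∀ i, IsRegularAt (f i) (p i))
    (hg : ∀ j, IsRegularAt (g j) (q j)) {y : (ι → ℝ) × (κ → ℝ)}
    (hy : y ∈ range (ascentCoord f g)) : DifferentiableAt ℝ (ascentCoordInv f g) y := by
  rw [mem_range_ascentCoord] at hy
  refine DifferentiableAt.prodMk (differentiableAt_pi.2 fun i => ?_)
    (differentiableAt_pi.2 fun j => ?_)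
  · exact (hasDerivAt_ascentPosition (hf i).contDiff (hf i).deriv_ne_zero
      (hy.1 i)).differentiableAt.comp y (f := fun y : (ι → ℝ) × (κ → ℝ) => y.1 i) (by fun_prop)
  · exact (hasDerivAt_ascentPosition (hg j).contDiff (hg j).deriv_ne_zero
      (hy.2 j)).differentiableAt.comp y (f := fun y : (ι → ℝ) × (κ → ℝ) => y.2 j) (by fun_prop)

lemma isOpen_range_ascentCoord (hf : ∀ i, IsRegularAt (f i) (p i))
    (hg : ∀ j, IsRegularAt (g j) (q j)) : IsOpen (range (ascentCoord f g)) := by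
  have : range (ascentCoord f g) = (univ.pi fun i => range (ascentTime (f i))) ×ˢ
      (univ.pi fun j => range (ascentTime (g j))) := by
    ext y
    rw [mem_range_ascentCoord]
    simp only [mem_prod, mem_univ_pi]
  rw [this]
  exact (isOpen_set_pi finite_univ fun i _ => (isOpenEmbedding_ascentTime (hf i).contDiff
    (hf i).deriv_ne_zero).isOpen_range).prod (isOpen_set_pi finite_univ fun j _ =>
    (isOpenEmbedding_ascentTime (hg j).contDiff (hg j).deriv_ne_zero).isOpen_range)

omit [Fintype ι] [Fintype κ] in
lemma ascentCoord_ascentCoordInv (hf : ∀ i, IsRegularAt (f i) (p i))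
    (hg : ∀ j, IsRegularAt (g j) (q j)) {y : (ι → ℝ) × (κ → ℝ)}
    (hy : y ∈ range (ascentCoord f g)) : ascentCoord f g (ascentCoordInv f g y) = y := by
  obtain ⟨x, rfl⟩ := hy
  rw [ascentCoordInv_ascentCoord hf hg]

lemma isOpen_image_ascentCoord (hf : ∀ i, IsRegularAt (f i) (p i))
    (hg : ∀ j, IsRegularAt (g j) (q j)) {O : Set ((ι → ℝ) × (κ → ℝ))} (hO : IsOpen O) :
    IsOpen (ascentCoord f g '' O) := by
  have : ascentCoord f g '' O = range (ascentCoord f g) ∩ ascentCoordInv f g ⁻¹' O := by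
    ext y
    constructor
    · rintro ⟨x, hx, rfl⟩
      exact ⟨mem_range_self x, by rwa [mem_preimage, ascentCoordInv_ascentCoord hf hg]⟩
    · rintro ⟨hy, hy'⟩
      exact ⟨_, hy', ascentCoord_ascentCoordInv hf hg hy⟩
  rw [this]
  exact ContinuousOn.isOpen_inter_preimage
    (fun y hy => (differentiableAt_ascentCoordInv hf hg hy).continuousAt.continuousWithinAt)
    (isOpen_range_ascentCoord hf hg) hO

lemma exists_Icc_ascentTime {f : ℝ → ℝ} {p : ℝ} (h : IsRegularAt f p) {R : ℝ} (hR : 0 ≤ R) :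
    ∃ a b, a ≤ b ∧ Icc a b ⊆ range (ascentTime f) ∧ ∀ θ, |θ| ≤ R → ascentTime f θ ∈ Icc a b := by
  have himg := (continuous_ascentTime h.contDiff h.deriv_ne_zero).continuousOn.image_Icc
    (show -R ≤ R by linarith)
  have hmem : ∀ θ, |θ| ≤ R → ascentTime f θ ∈
      Icc (sInf (ascentTime f '' Icc (-R) R)) (sSup (ascentTime f '' Icc (-R) R)) := by
    intro θ hθ
    rw [← himg]
    exact mem_image_of_mem _ (abs_le.1 hθ)
  have h0 := hmem 0 (by simpa using hR)
  refine ⟨_, _, h0.1.trans h0.2, ?_, hmem⟩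
  rw [← himg]
  exact image_subset_range _ _

/-- Each bounded set of parameters lies in a box of ascent coordinates. -/
lemma exists_isAscentBox (hf : ∀ i, IsRegularAt (f i) (p i))
    (hg : ∀ j, IsRegularAt (g j) (q j)) {R : ℝ} (hR : 0 ≤ R) :
    ∃ a b, IsAscentBox f g a b ∧ ∀ x ∈ Metric.closedBall 0 R, ascentCoord f g x ∈ Icc a b := by
  choose a b h1 h2 h3 using fun i => exists_Icc_ascentTime (hf i) hR
  choose a' b' h1' h2' h3' using fun j => exists_Icc_ascentTime (hg j) hR
  refine ⟨(a, a'), (b, b'), ⟨h1, h1', h2, h2'⟩, fun x hx => mem_Icc_coord.2 ⟨fun i => ?_,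
    fun j => ?_⟩⟩
  · refine h3 i _ ((norm_le_pi_norm x.1 i).trans ((norm_fst_le x).trans ?_))
    simpa using hx
  · refine h3' j _ ((norm_le_pi_norm x.2 j).trans ((norm_snd_le x).trans ?_))
    simpa using hx

/-- The ascent coordinates of a solution that stays in the ball of radius `R` solve the system
clamped to a box containing that ball. -/
lemma hasDerivAt_clamped (hf : ∀ i, IsRegularAt (f i) (p i))
    (hg : ∀ j, IsRegularAt (g j) (q j)) {R : ℝ} {a b : (ι → ℝ) × (κ → ℝ)}
    (hR : ∀ x ∈ Metric.closedBall 0 R, ascentCoord f g x ∈ Icc a b)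
    {γ : ℝ → (ι → ℝ) × (κ → ℝ)} {t : ℝ} (hγ : HasDerivAt γ (hiddenField C f g p q (γ t)) t)
    (ht : γ t ∈ Metric.closedBall 0 R) :
    HasDerivAt (fun t => ascentCoord f g (γ t))
      (clampedField C f g p q a b (ascentCoord f g (γ t))) t := by
  rw [clampedField_eq (hR _ ht)]
  exact hasDerivAt_ascentCoord_comp hf hg hγ

lemma exists_closedBall_of_continuous {E : Type*} [SeminormedAddCommGroup E] {γ : ℝ → E}
    (hγ : Continuous γ) (T : ℝ) :
    ∃ R ≥ 0, ∀ t ∈ Icc (-T) T, γ t ∈ Metric.closedBall 0 R := by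
  obtain ⟨R, hR⟩ := isCompact_Icc.exists_bound_of_continuousOn (s := Icc (-T) T) hγ.continuousOn
  exact ⟨max R 0, le_max_right _ _, fun t ht => by
    simpa using Or.inl (hR t ht)⟩

/-- Solutions of the hidden bilinear system that stay in a ball are determined by their initial
values. -/
lemma hiddenField_unique_Ioo (hf : ∀ i, IsRegularAt (f i) (p i))
    (hg : ∀ j, IsRegularAt (g j) (q j)) {R T : ℝ} (hR : 0 ≤ R) (hT : 0 < T)
    {γ δ : ℝ → (ι → ℝ) × (κ → ℝ)}
    (hγ : ∀ t ∈ Ioo (-T) T, HasDerivAt γ (hiddenField C f g p q (γ t)) t)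
    (hδ : ∀ t ∈ Ioo (-T) T, HasDerivAt δ (hiddenField C f g p q (δ t)) t)
    (hγR : ∀ t ∈ Ioo (-T) T, γ t ∈ Metric.closedBall 0 R)
    (hδR : ∀ t ∈ Ioo (-T) T, δ t ∈ Metric.closedBall 0 R) (h0 : γ 0 = δ 0) :
    EqOn γ δ (Ioo (-T) T) := by
  obtain ⟨a, b, hab, hRab⟩ := exists_isAscentBox hf hg hR
  obtain ⟨K, Ψ, hlip, -, -⟩ := exists_clamped_flow C hf hg hab
  intro t ht
  refine injective_ascentCoord hf hg ?_
  exact ODE_solution_unique_of_mem_Ioo (v := fun _ => clampedField C f g p q a b)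
    (s := fun _ => univ) (t₀ := 0) (fun _ _ => hlip.lipschitzOnWith)
    ⟨by linarith, hT⟩
    (fun t ht => ⟨hasDerivAt_clamped hf hg hRab (hγ t ht) (hγR t ht), trivial⟩)
    (fun t ht => ⟨hasDerivAt_clamped hf hg hRab (hδ t ht) (hδR t ht), trivial⟩)
    (by rw [h0]) ht

lemma hiddenField_unique (hf : ∀ i, IsRegularAt (f i) (p i))
    (hg : ∀ j, IsRegularAt (g j) (q j)) {γ δ : ℝ → (ι → ℝ) × (κ → ℝ)}
    (hγ : IsGlobalSolution (hiddenField C f g p q) γ)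
    (hδ : IsGlobalSolution (hiddenField C f g p q) δ) (h0 : γ 0 = δ 0) : γ = δ := by
  funext t
  obtain ⟨R, hR, hγR⟩ := exists_closedBall_of_continuous hγ.continuous (|t| + 1)
  obtain ⟨S, -, hδS⟩ := exists_closedBall_of_continuous hδ.continuous (|t| + 1)
  exact hiddenField_unique_Ioo hf hg (R := max R S) (T := |t| + 1) (hR.trans (le_max_left _ _))
    (by positivity) (fun t _ => hγ t) (fun t _ => hδ t)
    (fun t ht => Metric.closedBall_subset_closedBall (le_max_left _ _)
      (hγR t (Ioo_subset_Icc_self ht)))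
    (fun t ht => Metric.closedBall_subset_closedBall (le_max_right _ _)
      (hδS t (Ioo_subset_Icc_self ht))) h0 (abs_lt.1 (lt_add_one _))

/-- As long as a solution stays in a ball, its ascent coordinates follow the clamped flow. -/
lemma clamped_flow_eq (hf : ∀ i, IsRegularAt (f i) (p i))
    (hg : ∀ j, IsRegularAt (g j) (q j)) {R T : ℝ} {a b : (ι → ℝ) × (κ → ℝ)}
    (hR : ∀ x ∈ Metric.closedBall 0 R, ascentCoord f g x ∈ Icc a b) {K : ℝ≥0}
    (hlip : LipschitzWith K (clampedField C f g p q a b))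
    {Ψ : (ι → ℝ) × (κ → ℝ) → ℝ → (ι → ℝ) × (κ → ℝ)} (hΨ : IsFlow (clampedField C f g p q a b) Ψ)
    {γ : ℝ → (ι → ℝ) × (κ → ℝ)} (hγ : IsGlobalSolution (hiddenField C f g p q) γ)
    (hγR : ∀ t ∈ Ioo (-T) T, γ t ∈ Metric.closedBall 0 R) {t : ℝ} (ht : t ∈ Ioo (-T) T) :
    Ψ (ascentCoord f g (γ 0)) t = ascentCoord f g (γ t) := by
  refine ODE_solution_unique_of_mem_Ioo (v := fun _ => clampedField C f g p q a b)
    (s := fun _ => univ) (t₀ := 0) (fun _ _ => hlip.lipschitzOnWith)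
    ⟨by linarith [ht.1, ht.2], by linarith [ht.1, ht.2]⟩
    (fun t _ => ⟨hΨ.solution _ t, trivial⟩)
    (g := fun t => ascentCoord f g (γ t))
    (fun t ht => ⟨hasDerivAt_clamped hf hg hR (hγ t) (hγR t ht), trivial⟩)
    (hΨ.initial _) ht

/-- Global solutions form a flow. Joint continuity is local: by the tube lemma, trajectories that
start near a given one stay in a ball up to a given time, and there they are images of the
trajectories of a clamped flow, which is continuous. -/
theorem exists_isFlow_hiddenField (hf : ∀ i, IsRegularAt (f i) (p i))
    (hg : ∀ j, IsRegularAt (g j) (q j)) (hglob : HasGlobalSolutions (hiddenField C f g p q)) :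
    ∃ Φ, IsFlow (hiddenField C f g p q) Φ := by
  choose Φ hΦ0 hΦ using hglob
  refine ⟨Φ, ?_, hΦ0, hΦ, fun x₀ γ h0 hγ =>
    hiddenField_unique hf hg hγ (hΦ x₀) (h0.trans (hΦ0 x₀).symm)⟩
  rw [continuous_iff_continuousAt]
  rintro ⟨x₀, t₀⟩
  set T := |t₀| + 1 with hT
  have hTpos : 0 < T := by positivity
  obtain ⟨R', hR'0, hR'⟩ := exists_closedBall_of_continuous (hΦ x₀).continuous T
  set R := R' + 1 with hRdef
  have hR0 : 0 ≤ R := by linarith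
  have hball : ∀ t ∈ Icc (-T) T, Φ x₀ t ∈ Metric.ball 0 R := fun t ht =>
    Metric.closedBall_subset_ball (by linarith) (hR' t ht)
  obtain ⟨a, b, hab, hRab⟩ := exists_isAscentBox hf hg hR0
  obtain ⟨K, Ψ, hlip, hΨ, -⟩ := exists_clamped_flow C hf hg hab
  set e := ascentCoord f g with he
  have hΨcont : Continuous fun z : ((ι → ℝ) × (κ → ℝ)) × ℝ => Ψ (e z.1) z.2 :=
    hΨ.continuous.comp (((continuous_ascentCoord hf hg).comp continuous_fst).prodMk continuous_snd)
  -- the clamped trajectory on a smaller time interval stays in the image of the open ball, and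
  -- so do the nearby ones
  set T' := |t₀| + 1 / 2 with hT'
  have hT'pos : 0 < T' := by positivity
  have hsub : Icc (-T') T' ⊆ Ioo (-T) T := fun t ht => by
    constructor <;> linarith [ht.1, ht.2]
  have hopen : IsOpen ((fun z : ((ι → ℝ) × (κ → ℝ)) × ℝ => Ψ (e z.1) z.2) ⁻¹'
      (e '' Metric.ball 0 R)) :=
    (isOpen_image_ascentCoord hf hg Metric.isOpen_ball).preimage hΨcont
  obtain ⟨u, v, hu, -, hxu, hTv, huv⟩ := generalized_tube_lemma (s := {x₀}) (t := Icc (-T') T')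
    isCompact_singleton isCompact_Icc hopen (by
      rintro ⟨x, t⟩ ⟨hx, ht⟩
      rw [mem_singleton_iff] at hx
      subst hx
      have := clamped_flow_eq hf hg hRab hlip hΨ (hΦ x)
        (fun t ht => Metric.ball_subset_closedBall (hball t (Ioo_subset_Icc_self ht))) (hsub ht)
      rw [hΦ0] at this
      exact ⟨_, hball t (Ioo_subset_Icc_self (hsub ht)), this.symm⟩)
  have heq : ∀ x ∈ u, ∀ t ∈ Ioo (-T') T', Φ x t = ascentCoordInv f g (Ψ (e x) t) := by
    intro x hx t ht
    have hin : ∀ t ∈ Ioo (-T') T', Ψ (e x) t ∈ e '' Metric.ball 0 R := fun t ht => by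
      have : ((x, t) : _ × ℝ) ∈ u ×ˢ v := ⟨hx, hTv (Ioo_subset_Icc_self ht)⟩
      exact huv this
    have hinB : ∀ t ∈ Ioo (-T') T', ascentCoordInv f g (Ψ (e x) t) ∈ Metric.ball 0 R := by
      intro t ht
      obtain ⟨w, hw, hw'⟩ := hin t ht
      rwa [← hw', ascentCoordInv_ascentCoord hf hg]
    obtain ⟨S, -, hS⟩ := exists_closedBall_of_continuous (hΦ x).continuous T'
    refine hiddenField_unique_Ioo hf hg (C := C) (R := max R S) (hR0.trans (le_max_left _ _)) hT'pos
      (fun t _ => hΦ x t) (δ := fun t => ascentCoordInv f g (Ψ (e x) t)) (fun t ht => ?_)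
      (fun t ht => Metric.closedBall_subset_closedBall (le_max_right _ _)
        (hS t (Ioo_subset_Icc_self ht)))
      (fun t ht => Metric.closedBall_subset_closedBall (le_max_left _ _)
        (Metric.ball_subset_closedBall (hinB t ht))) ?_ ht
    · have hmem := image_subset_range _ _ (hin t ht)
      refine hasDerivAt_ascentCoordInv_comp hf hg ?_ hmem
      have h1 := hΨ.solution (e x) t
      have h2 : Ψ (e x) t ∈ Icc a b := by
        rw [← ascentCoord_ascentCoordInv hf hg hmem]
        exact hRab _ (Metric.ball_subset_closedBall (hinB t ht))
      rwa [clampedField_eq h2] at h1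
    · simp only [hΨ.initial, hΦ0, he, ascentCoordInv_ascentCoord hf hg]
  have ht₀ : t₀ ∈ Ioo (-T') T' := abs_lt.1 (by linarith)
  have hx₀ : x₀ ∈ u := hxu rfl
  have hmem₀ : Ψ (e x₀) t₀ ∈ range e :=
    image_subset_range _ _ (huv (show ((x₀, t₀) : _ × ℝ) ∈ u ×ˢ v from
      ⟨hx₀, hTv (Ioo_subset_Icc_self ht₀)⟩))
  have hca : ContinuousAt (fun z : ((ι → ℝ) × (κ → ℝ)) × ℝ =>
      ascentCoordInv f g (Ψ (e z.1) z.2)) (x₀, t₀) :=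
    ContinuousAt.comp (g := ascentCoordInv f g)
      (differentiableAt_ascentCoordInv hf hg hmem₀).continuousAt hΨcont.continuousAt
  refine hca.congr ?_
  filter_upwards [prod_mem_nhds (hu.mem_nhds hx₀) (isOpen_Ioo.mem_nhds ht₀)] with z hz
  exact (heq z.1 hz.1 z.2 hz.2).symm

end FlowExists

/-! ### Poincaré recurrence -/

section Recurrence

variable {ι κ : Type*} [Fintype ι] [Fintype κ]
  {C : Matrix ι κ ℝ} {f : ι → ℝ → ℝ} {g : κ → ℝ → ℝ} {p : ι → ℝ} {q : κ → ℝ}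

lemma measurableEmbedding_ascentCoord (hf : ∀ i, IsRegularAt (f i) (p i))
    (hg : ∀ j, IsRegularAt (g j) (q j)) : MeasurableEmbedding (ascentCoord f g) :=
  (continuous_ascentCoord hf hg).measurableEmbedding (injective_ascentCoord hf hg)

/-- The flow preserves the volume in ascent coordinates: on the set of initial values whose
trajectories stay in a ball for a while it agrees with a clamped flow, and these sets exhaust the
space. -/
lemma measurePreserving_flow_hiddenField (hf : ∀ i, IsRegularAt (f i) (p i))
    (hg : ∀ j, IsRegularAt (g j) (q j)) {Φ : (ι → ℝ) × (κ → ℝ) → ℝ → (ι → ℝ) × (κ → ℝ)}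
    (hΦ : IsFlow (hiddenField C f g p q) Φ) :
    MeasurePreserving (fun x => Φ x 1) (volume.comap (ascentCoord f g))
      (volume.comap (ascentCoord f g)) := by
  have he := measurableEmbedding_ascentCoord hf hg
  set e := ascentCoord f g with he_def
  set T : (ι → ℝ) × (κ → ℝ) → (ι → ℝ) × (κ → ℝ) := fun x => Φ x 1 with hT
  have hTmeas : Measurable T := (hΦ.continuous.comp (Continuous.prodMk_left 1)).measurable
  have hTsurj : Function.Surjective T := fun x => ⟨Φ x (-1), by
    simp only [hT, hΦ.flow_flow, neg_add_cancel, hΦ.initial]⟩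
  set X : ℕ → Set ((ι → ℝ) × (κ → ℝ)) := fun k =>
    {x | ∀ t ∈ Ioo (-2 : ℝ) 2, Φ x t ∈ Metric.closedBall 0 (k : ℝ)} with hX
  have hXmono : Monotone X := fun k l hkl x hx t ht =>
    Metric.closedBall_subset_closedBall (Nat.cast_le.2 hkl) (hx t ht)
  have hXuniv : ⋃ k, X k = univ := by
    refine eq_univ_of_forall fun x => ?_
    obtain ⟨R, -, hR⟩ := exists_closedBall_of_continuous (hΦ.solution x).continuous 2
    obtain ⟨k, hk⟩ := exists_nat_ge R
    exact mem_iUnion.2 ⟨k, fun t ht =>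
      Metric.closedBall_subset_closedBall hk (hR t (Ioo_subset_Icc_self ht))⟩
  have key : ∀ (S : Set ((ι → ℝ) × (κ → ℝ))) (k : ℕ),
      volume (e '' (T ⁻¹' S ∩ X k)) = volume (e '' (S ∩ T '' X k)) := by
    intro S k
    obtain ⟨a, b, hab, hRab⟩ := exists_isAscentBox hf hg k.cast_nonneg
    obtain ⟨K, Ψ, hlip, hΨ, hmp⟩ := exists_clamped_flow C hf hg hab
    have hcf : ∀ x ∈ X k, Ψ (e x) 1 = e (T x) := fun x hx => by
      have := clamped_flow_eq hf hg hRab hlip hΨ (hΦ.solution x) hx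
        (show (1 : ℝ) ∈ Ioo (-2 : ℝ) 2 by constructor <;> norm_num)
      rwa [hΦ.initial] at this
    have hinv : ∀ y, Ψ (Ψ y 1) (-1) = y := fun y => by
      rw [hΨ.flow_flow, add_neg_cancel, hΨ.initial]
    have hinv' : ∀ y, Ψ (Ψ y (-1)) 1 = y := fun y => by
      rw [hΨ.flow_flow, neg_add_cancel, hΨ.initial]
    have hemb : MeasurableEmbedding fun y => Ψ y (-1) :=
      (hΨ.continuous.comp (Continuous.prodMk_left (-1))).measurableEmbedding
        (Function.LeftInverse.injective (g := fun y => Ψ y 1) hinv')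
    rw [← (hmp (-1)).measure_preimage_emb hemb]
    congr 1
    ext y
    constructor
    · rintro ⟨x, ⟨hxS, hxX⟩, hx⟩
      refine ⟨T x, ⟨hxS, mem_image_of_mem _ hxX⟩, ?_⟩
      rw [← hcf x hxX, hx]
      exact hinv' y
    · rintro ⟨-, ⟨hxS, x, hxX, rfl⟩, rfl⟩
      refine ⟨x, ⟨hxS, hxX⟩, ?_⟩
      simp only [← hcf x hxX, hinv]
  refine ⟨hTmeas, Measure.ext fun S hS => ?_⟩
  rw [Measure.map_apply hTmeas hS, he.comap_apply, he.comap_apply]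
  have h1 : T ⁻¹' S = ⋃ k, T ⁻¹' S ∩ X k := by rw [← inter_iUnion, hXuniv, inter_univ]
  have h2 : S = ⋃ k, S ∩ T '' X k := by
    rw [← inter_iUnion, ← image_iUnion, hXuniv, image_univ, hTsurj.range_eq, inter_univ]
  have hm1 : Monotone fun k => e '' (T ⁻¹' S ∩ X k) := fun k l hkl =>
    image_mono (inter_subset_inter_right _ (hXmono hkl))
  have hm2 : Monotone fun k => e '' (S ∩ T '' X k) := fun k l hkl =>
    image_mono (inter_subset_inter_right _ (image_mono (hXmono hkl)))
  conv_lhs => rw [h1, image_iUnion, hm1.measure_iUnion]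
  conv_rhs => rw [h2, image_iUnion, hm2.measure_iUnion]
  simp only [key]

/-- The energy as a function of the parameters. -/
def hiddenEnergy (f : ι → ℝ → ℝ) (g : κ → ℝ → ℝ) (p : ι → ℝ) (q : κ → ℝ)
    (x : (ι → ℝ) × (κ → ℝ)) : ℝ :=
  energy (fun i => ascentValue (f i)) (fun j => ascentValue (g j)) p q (centerCoord f g p q)
    (ascentCoord f g x)

lemma IsRegularAt.hasDerivAt_potential {f : ℝ → ℝ} {p s : ℝ} (h : IsRegularAt f p)
    (hs : s ∈ range (ascentTime f)) :
    HasDerivAt (potential (ascentValue f) p (ascentCenter f p)) (ascentValue f s - p) s :=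
  HiddenBilinear.hasDerivAt_potential (isOpenEmbedding_ascentTime h.contDiff
    h.deriv_ne_zero).isOpen_range (ordConnected_range_ascentTime h.contDiff h.deriv_ne_zero)
    (continuousOn_ascentValue h.contDiff h.deriv_ne_zero) p (ascentCenter_mem_range f p) hs

lemma hiddenEnergy_flow (hf : ∀ i, IsRegularAt (f i) (p i))
    (hg : ∀ j, IsRegularAt (g j) (q j)) {γ : ℝ → (ι → ℝ) × (κ → ℝ)}
    (hγ : IsGlobalSolution (hiddenField C f g p q) γ) (t : ℝ) :
    hiddenEnergy f g p q (γ t) = hiddenEnergy f g p q (γ 0) := by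
  have hd : ∀ t, HasDerivAt (fun t => hiddenEnergy f g p q (γ t)) 0 t := fun t =>
    hasDerivAt_energy (hasDerivAt_ascentCoord_comp hf hg (hγ t))
      (fun i => (hf i).hasDerivAt_potential (mem_range_self _))
      (fun j => (hg j).hasDerivAt_potential (mem_range_self _))
  exact is_const_of_deriv_eq_zero (fun t => (hd t).differentiableAt) (fun t => (hd t).deriv) t 0

lemma continuous_hiddenEnergy (hf : ∀ i, IsRegularAt (f i) (p i))
    (hg : ∀ j, IsRegularAt (g j) (q j)) : Continuous (hiddenEnergy f g p q) := by
  have hpot : ∀ {f : ℝ → ℝ} {p : ℝ}, IsRegularAt f p →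
      Continuous fun θ => potential (ascentValue f) p (ascentCenter f p) (ascentTime f θ) :=
    fun {f p} h => continuous_iff_continuousAt.2 fun θ =>
      ContinuousAt.comp (f := ascentTime f) (h.hasDerivAt_potential (mem_range_self θ)).continuousAt
        (continuous_ascentTime h.contDiff h.deriv_ne_zero).continuousAt
  refine Continuous.add (continuous_finsetSum _ fun i _ => ?_)
    (continuous_finsetSum _ fun j _ => ?_)
  · exact (hpot (hf i)).comp ((continuous_apply i).comp continuous_fst)
  · exact (hpot (hg j)).comp ((continuous_apply j).comp continuous_snd)

/-- Energy sublevel sets are bounded in ascent coordinates, so they have finite volume there. -/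
lemma volume_image_sublevel_lt_top (hf : ∀ i, IsRegularAt (f i) (p i))
    (hg : ∀ j, IsRegularAt (g j) (q j)) (c : ℝ) :
    volume (ascentCoord f g '' {x | hiddenEnergy f g p q x ≤ c}) < ∞ := by
  choose ε hε δ hδ h using fun i => (hf i).exists_coercive
  choose ε' hε' δ' hδ' h' using fun j => (hg j).exists_coercive
  have haux : ∀ {s s₀ ε δ v : ℝ}, 0 < δ → δ * (|s - s₀| - ε) ≤ v → v ≤ c →
      s ∈ Icc (s₀ - (ε + c / δ)) (s₀ + (ε + c / δ)) := by
    intro s s₀ ε δ v hδ h1 h2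
    have h3 := h1.trans h2
    rw [mul_comm, ← le_div_iff₀ hδ] at h3
    have := abs_le.1 (show |s - s₀| ≤ ε + c / δ by linarith)
    constructor <;> linarith
  set z₀ := centerCoord f g p q with hz₀
  set a : (ι → ℝ) × (κ → ℝ) :=
    (fun i => z₀.1 i - (ε i + c / δ i), fun j => z₀.2 j - (ε' j + c / δ' j)) with ha
  set b : (ι → ℝ) × (κ → ℝ) :=
    (fun i => z₀.1 i + (ε i + c / δ i), fun j => z₀.2 j + (ε' j + c / δ' j)) with hb
  refine (measure_mono (t := Icc a b) ?_).trans_lt isCompact_Icc.measure_lt_top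
  rintro - ⟨x, hx, rfl⟩
  obtain ⟨h1, h2⟩ := potential_le_energy (p := p) (q := q) (z₀ := z₀) (y := ascentCoord f g x)
    (F := fun i => ascentValue (f i)) (G := fun j => ascentValue (g j))
    (fun i => (hf i).potential_nonneg (mem_range_self _))
    (fun j => (hg j).potential_nonneg (mem_range_self _))
  exact mem_Icc_coord.2 ⟨fun i => haux (hδ i) (h i _ (mem_range_self _)) ((h1 i).trans hx),
    fun j => haux (hδ' j) (h' j _ (mem_range_self _)) ((h2 j).trans hx)⟩

lemma isRecurrentPoint_of_frequently {X : Type*} [TopologicalSpace X] {Φ : X → ℝ → X} {x : X}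
    (h : ∀ s ∈ 𝓝 x, ∃ᶠ n : ℕ in atTop, Φ x n ∈ s) : IsRecurrentPoint Φ x := by
  intro s hs
  obtain ⟨k, hk, hks⟩ := extraction_of_frequently_atTop (h s hs)
  exact ⟨fun n => k n, fun a b hab => Nat.cast_lt.2 (hk hab),
    tendsto_natCast_atTop_atTop.comp hk.tendsto_atTop, hks⟩

/-- Almost every point is recurrent, since the flow preserves the volume in ascent coordinates and
the energy, whose sublevel sets have finite volume. -/
theorem volume_not_isRecurrentPoint_hiddenField (hf : ∀ i, IsRegularAt (f i) (p i))
    (hg : ∀ j, IsRegularAt (g j) (q j)) {Φ : (ι → ℝ) × (κ → ℝ) → ℝ → (ι → ℝ) × (κ → ℝ)}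
    (hΦ : IsFlow (hiddenField C f g p q) Φ) : volume {x | ¬ IsRecurrentPoint Φ x} = 0 := by
  have he := measurableEmbedding_ascentCoord hf hg
  have hmp := measurePreserving_flow_hiddenField hf hg hΦ
  set e := ascentCoord f g with he_def
  set ν : Measure ((ι → ℝ) × (κ → ℝ)) := volume.comap e with hν
  set B := {x | ¬ IsRecurrentPoint Φ x} with hB
  have hsub : ∀ c : ℕ, ν (B ∩ {x | hiddenEnergy f g p q x ≤ c}) = 0 := by
    intro c
    set A := {x | hiddenEnergy f g p q x ≤ c} with hA
    have hAmeas : MeasurableSet A :=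
      (isClosed_le (continuous_hiddenEnergy hf hg) continuous_const).measurableSet
    have hAinv : (fun x => Φ x 1) ⁻¹' A = A := by
      ext x
      have := hiddenEnergy_flow hf hg (hΦ.solution x) 1
      rw [hΦ.initial] at this
      simp only [hA, mem_preimage, mem_ofPred_eq, this]
    have hmpA := hmp.restrict_preimage hAmeas
    rw [hAinv] at hmpA
    have : IsFiniteMeasure (ν.restrict A) := ⟨by
      rw [Measure.restrict_apply_univ, hν, he.comap_apply]
      exact volume_image_sublevel_lt_top hf hg c⟩
    have hrec := hmpA.conservative.ae_frequently_mem_of_mem_nhds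
    have hiter : ∀ (n : ℕ) x, (fun x => Φ x 1)^[n] x = Φ x n := by
      intro n
      induction n with
      | zero => intro x; simp [hΦ.initial]
      | succ n ih =>
        intro x
        rw [Function.iterate_succ_apply', ih, hΦ.flow_flow]
        push_cast
        rfl
    refine measure_mono_null ?_ (ae_iff.1 ((ae_restrict_iff' hAmeas).1 hrec))
    rintro x ⟨hxB, hxA⟩ hx
    exact hxB (isRecurrentPoint_of_frequently fun s hs => by simpa only [hiter] using hx hxA s hs)
  have hνB : ν B = 0 := by
    have : B = ⋃ c : ℕ, B ∩ {x | hiddenEnergy f g p q x ≤ c} := by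
      rw [← inter_iUnion, eq_comm, inter_eq_left]
      intro x _
      obtain ⟨c, hc⟩ := exists_nat_ge (hiddenEnergy f g p q x)
      exact mem_iUnion.2 ⟨c, hc⟩
    rw [this]
    exact measure_iUnion_null hsub
  rw [hν, he.comap_apply] at hνB
  -- the inverse of the coordinate change is differentiable, so it maps null sets to null sets
  have hBimg : B = ascentCoordInv f g '' (e '' B) := by
    rw [image_image]
    simp only [he_def, ascentCoordInv_ascentCoord hf hg, image_id']
  rw [hBimg]
  have : (volume : Measure ((ι → ℝ) × (κ → ℝ))).IsAddHaarMeasure :=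
    Measure.prod.instIsAddHaarMeasure volume volume
  refine addHaar_image_eq_zero_of_differentiableOn_of_addHaar_eq_zero volume
    (fun y hy => ?_) hνB
  exact (differentiableAt_ascentCoordInv hf hg
    (image_subset_range _ _ hy)).differentiableWithinAt

end Recurrence

/-! ### Transport of flows along linear equivalences -/

section Transport

variable {X Y : Type*} [NormedAddCommGroup X] [NormedSpace ℝ X] [NormedAddCommGroup Y]
  [NormedSpace ℝ Y] {V : X → X} {W : Y → Y} (Λ : X ≃L[ℝ] Y)

lemma IsGlobalSolution.map (h : ∀ x, Λ (V x) = W (Λ x)) {γ : ℝ → X}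
    (hγ : IsGlobalSolution V γ) : IsGlobalSolution W (fun t => Λ (γ t)) := fun t => by
  rw [← h]
  exact Λ.hasFDerivAt.comp_hasDerivAt t (hγ t)

lemma HasGlobalSolutions.map (h : ∀ x, Λ (V x) = W (Λ x)) (hV : HasGlobalSolutions V) :
    HasGlobalSolutions W := fun y₀ => by
  obtain ⟨γ, h0, hγ⟩ := hV (Λ.symm y₀)
  exact ⟨_, by simp [h0], hγ.map Λ h⟩

lemma symm_conj (h : ∀ x, Λ (V x) = W (Λ x)) (y : Y) : Λ.symm (W y) = V (Λ.symm y) := by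
  rw [Λ.symm_apply_eq, h, Λ.apply_symm_apply]

lemma IsFlow.comap (h : ∀ x, Λ (V x) = W (Λ x)) {Ψ : Y → ℝ → Y} (hΨ : IsFlow W Ψ) :
    IsFlow V (fun x t => Λ.symm (Ψ (Λ x) t)) where
  continuous := Λ.symm.continuous.comp (hΨ.continuous.comp
    ((Λ.continuous.comp continuous_fst).prodMk continuous_snd))
  initial x := by simp [hΨ.initial]
  solution x := (hΨ.solution (Λ x)).map Λ.symm (symm_conj Λ h)
  unique x γ h0 hγ := by
    have := hΨ.unique (Λ x) _ (by rw [h0]) (hγ.map Λ h)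
    funext t
    rw [← congrFun this t, Λ.symm_apply_apply]

lemma IsRecurrentPoint.comap {Ψ : Y → ℝ → Y} {x : X} (hx : IsRecurrentPoint Ψ (Λ x)) :
    IsRecurrentPoint (fun x t => Λ.symm (Ψ (Λ x) t)) x := by
  intro s hs
  obtain ⟨t, h1, h2, h3⟩ := hx (Λ.symm ⁻¹' s)
    (Λ.symm.continuous.continuousAt.preimage_mem_nhds (by rwa [Λ.symm_apply_apply]))
  exact ⟨t, h1, h2, h3⟩

lemma volume_not_isRecurrentPoint_comap {X Y : Type*} [NormedAddCommGroup X] [NormedSpace ℝ X]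
    [NormedAddCommGroup Y] [NormedSpace ℝ Y] [FiniteDimensional ℝ X] [FiniteDimensional ℝ Y]
    [MeasureSpace X] [BorelSpace X] [MeasureSpace Y] [BorelSpace Y]
    [(volume : Measure X).IsAddHaarMeasure] [(volume : Measure Y).IsAddHaarMeasure] (Λ : X ≃L[ℝ] Y)
    {Ψ : Y → ℝ → Y} (hΨ : volume {y | ¬ IsRecurrentPoint Ψ y} = 0) :
    volume {x | ¬ IsRecurrentPoint (fun x t => Λ.symm (Ψ (Λ x) t)) x} = 0 := by
  have hac : (volume : Measure X).map Λ ≪ volume := by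
    have : ((volume : Measure X).map Λ).IsAddHaarMeasure :=
      Measure.MapLinearEquiv.isAddHaarMeasure volume Λ.toLinearEquiv
    exact Measure.absolutelyContinuous_isAddHaarMeasure _ _
  have hq : Measure.QuasiMeasurePreserving Λ (volume : Measure X) volume :=
    ⟨Λ.continuous.measurable, hac⟩
  exact measure_mono_null (fun x hx hx' => hx (IsRecurrentPoint.comap Λ hx'))
    (hq.preimage_null hΨ)

end Transport

/-! ### One-dimensional parameters -/

section Parameters

/-- An injective continuous real function lives on a space of dimension at most one, since
removing a point from a space of larger dimension does not disconnect it. -/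
lemma le_one_of_injective_continuous {d : ℕ} {f : EuclideanSpace ℝ (Fin d) → ℝ}
    (hf : Continuous f) (hinj : Function.Injective f) : d ≤ 1 := by
  by_contra! hd
  have hrank : 1 < Module.rank ℝ (EuclideanSpace ℝ (Fin d)) := by
    rw [← Module.finrank_eq_rank, finrank_euclideanSpace_fin]
    exact_mod_cast hd
  have : Nontrivial (EuclideanSpace ℝ (Fin d)) := Module.nontrivial_of_finrank_pos (R := ℝ) (by
    rw [finrank_euclideanSpace_fin]; omega)
  obtain ⟨x, y, hxy⟩ := exists_pair_ne (EuclideanSpace ℝ (Fin d))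
  wlog hlt : f x < f y generalizing x y
  · exact this y x hxy.symm (lt_of_le_of_ne (not_lt.1 hlt) (hinj.ne hxy.symm))
  have hmid : (f x + f y) / 2 ∈ Icc (f x) (f y) := ⟨by linarith, by linarith⟩
  obtain ⟨z, -, hz⟩ := isPreconnected_univ.intermediate_value (mem_univ x) (mem_univ y)
    hf.continuousOn hmid
  have hxz : x ≠ z := by rintro rfl; linarith
  have hyz : y ≠ z := by rintro rfl; linarith
  obtain ⟨w, hw, hw'⟩ := (isConnected_compl_singleton_of_one_lt_rank hrank
    z).isPreconnected.intermediate_value (mem_compl_singleton_iff.2 hxz)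
    (mem_compl_singleton_iff.2 hyz) hf.continuousOn hmid
  exact hw (hinj (hw'.trans hz.symm))

lemma eq_one_of_injective_of_gradient_ne_zero {d : ℕ} {f : EuclideanSpace ℝ (Fin d) → ℝ}
    (hf : Continuous f) (hinj : Function.Injective f) {x : EuclideanSpace ℝ (Fin d)}
    (hx : gradient f x ≠ 0) : d = 1 := by
  have h1 := le_one_of_injective_continuous hf hinj
  rcases Nat.le_one_iff_eq_zero_or_eq_one.1 h1 with rfl | h
  · exact absurd (Subsingleton.elim _ _) hx
  · exact h

/-- A function of a one-dimensional parameter vector as a function of a real number. -/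
def onLine (f : EuclideanSpace ℝ (Fin 1) → ℝ) (t : ℝ) : ℝ :=
  f (t • EuclideanSpace.single (0 : Fin 1) (1 : ℝ))

lemma smul_single_eq (x : EuclideanSpace ℝ (Fin 1)) :
    x 0 • EuclideanSpace.single (0 : Fin 1) (1 : ℝ) = x := by
  ext i
  fin_cases i
  simp

lemma onLine_apply_zero (f : EuclideanSpace ℝ (Fin 1) → ℝ) (x : EuclideanSpace ℝ (Fin 1)) :
    onLine f (x 0) = f x := by
  rw [onLine, smul_single_eq]

lemma gradient_apply_zero {f : EuclideanSpace ℝ (Fin 1) → ℝ} (hf : Differentiable ℝ f)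
    (x : EuclideanSpace ℝ (Fin 1)) : gradient f x 0 = deriv (onLine f) (x 0) := by
  have h1 : HasDerivAt (onLine f) (fderiv ℝ f x (EuclideanSpace.single (0 : Fin 1) (1 : ℝ)))
      (x 0) := by
    have hx := (hf (x 0 • EuclideanSpace.single (0 : Fin 1) (1 : ℝ))).hasFDerivAt
    have := hx.comp_hasDerivAt (x 0)
      ((hasDerivAt_id (x 0)).smul_const (EuclideanSpace.single (0 : Fin 1) (1 : ℝ)))
    simp only [id_eq, one_smul, smul_single_eq] at this
    exact this
  rw [h1.deriv, ← inner_gradient_left]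
  simp only [EuclideanSpace.inner_single_right]
  simp

lemma contDiff_onLine {f : EuclideanSpace ℝ (Fin 1) → ℝ} (hf : ContDiff ℝ 2 f) :
    ContDiff ℝ 2 (onLine f) :=
  hf.comp (contDiff_id.smul contDiff_const)

lemma isRegularAt_onLine {f : EuclideanSpace ℝ (Fin 1) → ℝ} (hf : ContDiff ℝ 2 f)
    (hgrad : ∀ x, gradient f x ≠ 0) {p : ℝ} (hp : p ∈ range f) : IsRegularAt (onLine f) p where
  contDiff := contDiff_onLine hf
  deriv_ne_zero t := by
    have h := gradient_apply_zero (hf.differentiable (by norm_num))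
      (t • EuclideanSpace.single (0 : Fin 1) (1 : ℝ))
    have ht : (t • EuclideanSpace.single (0 : Fin 1) (1 : ℝ)) 0 = t := by simp
    rw [ht] at h
    rw [← h]
    intro h0
    refine hgrad (t • EuclideanSpace.single (0 : Fin 1) (1 : ℝ)) ?_
    rw [← smul_single_eq (gradient f _), h0, zero_smul]
  mem_range := by
    obtain ⟨x, rfl⟩ := hp
    exact ⟨x 0, onLine_apply_zero f x⟩

lemma hasGlobalSolutions_onLine {f : EuclideanSpace ℝ (Fin 1) → ℝ} (hf : Differentiable ℝ f)
    (h : HasGlobalSolutions (gradient f)) : HasGlobalSolutions (deriv (onLine f)) := by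
  intro t₀
  obtain ⟨γ, h0, hγ⟩ := h (t₀ • EuclideanSpace.single (0 : Fin 1) (1 : ℝ))
  refine ⟨fun t => γ t 0, by simp [h0], fun t => ?_⟩
  rw [← gradient_apply_zero hf]
  exact (EuclideanSpace.proj (𝕜 := ℝ) (0 : Fin 1)).hasFDerivAt.comp_hasDerivAt t (hγ t)

lemma isRegularAt_id (p : ℝ) : IsRegularAt id p where
  contDiff := contDiff_id
  deriv_ne_zero x := by simp
  mem_range := ⟨p, rfl⟩

lemma surjective_ascentTime_id : Function.Surjective (ascentTime id) :=
  surjective_ascentTime_of_deriv_le_one contDiff_id (by simp) (by simp)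

lemma onLine_sigmoidFun : onLine sigmoidFun = Real.sigmoid := by
  funext t
  simp [onLine, sigmoidFun, Real.sigmoid_def]

lemma deriv_sigmoid_pos (x : ℝ) : 0 < deriv Real.sigmoid x := by
  rw [Real.deriv_sigmoid]
  exact mul_pos (Real.sigmoid_pos x) (sub_pos.2 (Real.sigmoid_lt_one x))

lemma isRegularAt_onLine_sigmoidFun {p : ℝ} (h0 : 0 < p) (h1 : p < 1) :
    IsRegularAt (onLine sigmoidFun) p := by
  rw [onLine_sigmoidFun]
  exact ⟨contDiff_sigmoid.of_le le_top, fun x => (deriv_sigmoid_pos x).ne',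
    by rw [Real.range_sigmoid]; exact ⟨h0, h1⟩⟩

lemma surjective_ascentTime_onLine_sigmoidFun :
    Function.Surjective (ascentTime (onLine sigmoidFun)) := by
  rw [onLine_sigmoidFun]
  refine surjective_ascentTime_of_deriv_le_one (contDiff_sigmoid.of_le le_top)
    deriv_sigmoid_pos fun x => ?_
  rw [Real.deriv_sigmoid]
  exact mul_le_one₀ (Real.sigmoid_le_one x) (sub_nonneg.2 (Real.sigmoid_le_one x))
    (by linarith [Real.sigmoid_pos x])

lemma differentiable_sigmoidFun : Differentiable ℝ sigmoidFun := by
  have : sigmoidFun = fun x => Real.sigmoid (x 0) := rfl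
  rw [this]
  exact differentiable_sigmoid.comp (EuclideanSpace.proj (𝕜 := ℝ) (0 : Fin 1)).differentiable

end Parameters

/-! ### The Lagrangian dynamics as a hidden bilinear game -/

section Lagrangian

variable {N M : ℕ}

lemma eq_of_sum_mul_eq {α : Type*} [Fintype α] {p w : α → ℝ} {c : ℝ} (hp : p ∈ stdSimplex ℝ α)
    (hpos : ∀ i, 0 < p i) (hw : ∀ i, c ≤ w i) (hsum : ∑ i, p i * w i = c) (i : α) : w i = c := by
  have h0 : ∑ i, p i * (w i - c) = 0 := by
    simp only [mul_sub, Finset.sum_sub_distrib, ← Finset.sum_mul, hp.2, hsum, one_mul, sub_self]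
  have := (Finset.sum_eq_zero_iff_of_nonneg fun i _ =>
    mul_nonneg (hpos i).le (sub_nonneg.2 (hw i))).1 h0 i (Finset.mem_univ i)
  exact sub_eq_zero.1 ((mul_eq_zero.1 this).resolve_left (hpos i).ne')

/-- A fully mixed equilibrium makes both players indifferent between their pure strategies. -/
lemma IsFullyMixedNash.indifferent {U : Matrix (Fin N) (Fin M) ℝ} {p : Fin N → ℝ}
    {q : Fin M → ℝ} (h : IsFullyMixedNash U p q) :
    ∃ v, (∀ i, ∑ j, U i j * q j = v) ∧ ∀ j, ∑ i, U i j * p i = v := by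
  refine ⟨p ⬝ᵥ U.mulVec q, fun i => ?_, fun j => ?_⟩
  · refine eq_of_sum_mul_eq (w := U.mulVec q) h.left_mem h.left_pos (fun i => ?_) rfl i
    have := h.left_opt _ (single_mem_stdSimplex ℝ i)
    rwa [single_one_dotProduct] at this
  · have hw : ∀ y, p ⬝ᵥ U.mulVec y = ∑ j, (∑ i, U i j * p i) * y j := by
      intro y
      rw [Matrix.dotProduct_mulVec]
      simp only [dotProduct, Matrix.vecMul, mul_comm (U _ _)]
    have := eq_of_sum_mul_eq (w := fun j => -∑ i, U i j * p i) (c := -(p ⬝ᵥ U.mulVec q))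
      h.right_mem h.right_pos (fun j => ?_) ?_ j
    · exact neg_injective this
    · have := h.right_opt _ (single_mem_stdSimplex ℝ j)
      rw [hw (Pi.single j 1)] at this
      simpa [Pi.single_apply] using this
    · rw [hw]
      simp only [mul_neg, Finset.sum_neg_distrib, mul_comm]

/-- The payoff matrix bordered by ones: the multipliers `mu`, `lam` become one more parameter of
the first and of the second player, with identity value functions. -/
def borderedMatrix (U : Matrix (Fin N) (Fin M) ℝ) : Matrix (Option (Fin N)) (Option (Fin M)) ℝ
  | some i, some j => U i j
  | some _, none => 1
  | none, some _ => 1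
  | none, none => 0

/-- The value functions of the parameters of one player, the multiplier included. -/
def borderedFun (f : Fin N → EuclideanSpace ℝ (Fin 1) → ℝ) : Option (Fin N) → ℝ → ℝ
  | some i => onLine (f i)
  | none => id

/-- The equilibrium values of the parameters of one player, the multiplier included. -/
def borderedValue (v : ℝ) (p : Fin N → ℝ) : Option (Fin N) → ℝ
  | some i => p i
  | none => -v

/-- The states with one-dimensional parameters as pairs of real vectors
`((θ, mu), (φ, lam))`. -/
def stateEquiv (N M : ℕ) : State (fun _ : Fin N => 1) (fun _ : Fin M => 1) ≃L[ℝ]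
    (Option (Fin N) → ℝ) × (Option (Fin M) → ℝ) :=
  LinearEquiv.toContinuousLinearEquiv
    { toFun := fun x =>
        (fun i => i.elim x.2.2.2 fun i => x.1 i 0, fun j => j.elim x.2.2.1 fun j => x.2.1 j 0)
      map_add' := fun x y => by
        refine Prod.ext (funext fun i => ?_) (funext fun j => ?_)
        · cases i <;> rfl
        · cases j <;> rfl
      map_smul' := fun c x => by
        refine Prod.ext (funext fun i => ?_) (funext fun j => ?_)
        · cases i <;> rfl
        · cases j <;> rfl
      invFun := fun y =>
        (fun i => y.1 (some i) • EuclideanSpace.single 0 1,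
          fun j => y.2 (some j) • EuclideanSpace.single 0 1, y.2 none, y.1 none)
      left_inv := fun x => by
        refine Prod.ext (funext fun i => ?_) (Prod.ext (funext fun j => ?_) rfl)
        · exact smul_single_eq _
        · exact smul_single_eq _
      right_inv := fun y => by
        refine Prod.ext (funext fun i => ?_) (funext fun j => ?_)
        · cases i <;> simp
        · cases j <;> simp }

lemma stateEquiv_cgdaField {U : Matrix (Fin N) (Fin M) ℝ} {p : Fin N → ℝ} {q : Fin M → ℝ} {v : ℝ}
    (hp : ∑ i, p i = 1) (hq : ∑ j, q j = 1) (hUq : ∀ i, ∑ j, U i j * q j = v)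
    (hUp : ∀ j, ∑ i, U i j * p i = v) {f : Fin N → EuclideanSpace ℝ (Fin 1) → ℝ}
    {g : Fin M → EuclideanSpace ℝ (Fin 1) → ℝ} (hf : ∀ i, Differentiable ℝ (f i))
    (hg : ∀ j, Differentiable ℝ (g j)) (x : State (fun _ : Fin N => 1) (fun _ : Fin M => 1)) :
    stateEquiv N M (cgdaField U f g x) =
      hiddenField (borderedMatrix U) (borderedFun f) (borderedFun g) (borderedValue v p)
        (borderedValue v q) (stateEquiv N M x) := by
  obtain ⟨θ, φ, lam, mu⟩ := x
  have e1 : ∀ i, (stateEquiv N M (θ, φ, lam, mu)).1 (some i) = θ i 0 := fun _ => rfl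
  have e2 : ∀ j, (stateEquiv N M (θ, φ, lam, mu)).2 (some j) = φ j 0 := fun _ => rfl
  have e3 : (stateEquiv N M (θ, φ, lam, mu)).1 none = mu := rfl
  have e4 : (stateEquiv N M (θ, φ, lam, mu)).2 none = lam := rfl
  refine Prod.ext (funext fun i => ?_) (funext fun j => ?_)
  · cases i with
    | none =>
      change -(∑ j, g j (φ j) - 1) = _
      simp [hiddenField, leftField, borderedMatrix, borderedFun, borderedValue,
        Fintype.sum_option, e2, e3, onLine_apply_zero, Finset.sum_sub_distrib, hq]
    | some i =>
      change (-((∑ j, U i j * g j (φ j) + lam) • gradient (f i) (θ i))) 0 = _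
      simp only [hiddenField, leftField, borderedMatrix, borderedFun, borderedValue,
        Fintype.sum_option, e1, e2, e4, onLine_apply_zero, Finset.sum_sub_distrib, mul_sub, hUq,
        ← gradient_apply_zero (hf i), id_eq, PiLp.neg_apply, PiLp.smul_apply, smul_eq_mul]
      ring
  · cases j with
    | none =>
      change ∑ i, f i (θ i) - 1 = _
      simp [hiddenField, rightField, borderedMatrix, borderedFun, borderedValue,
        Fintype.sum_option, e1, e4, onLine_apply_zero, Finset.sum_sub_distrib, hp]
    | some j =>
      change ((∑ i, U i j * f i (θ i) + mu) • gradient (g j) (φ j)) 0 = _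
      simp only [hiddenField, rightField, borderedMatrix, borderedFun, borderedValue,
        Fintype.sum_option, e1, e2, e3, onLine_apply_zero, Finset.sum_sub_distrib, mul_sub, hUp,
        ← gradient_apply_zero (hg j), id_eq, PiLp.smul_apply, smul_eq_mul]
      ring

lemma isRegularAt_borderedFun {f : Fin N → EuclideanSpace ℝ (Fin 1) → ℝ} {p : Fin N → ℝ}
    (v : ℝ) (h : ∀ i, IsRegularAt (onLine (f i)) (p i)) (i : Option (Fin N)) :
    IsRegularAt (borderedFun f i) (borderedValue v p i) := by
  cases i with
  | none => exact isRegularAt_id _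
  | some i => exact h i

lemma surjective_ascentTime_borderedFun {f : Fin N → EuclideanSpace ℝ (Fin 1) → ℝ}
    (h : ∀ i, Function.Surjective (ascentTime (onLine (f i)))) (i : Option (Fin N)) :
    Function.Surjective (ascentTime (borderedFun f i)) := by
  cases i with
  | none => exact surjective_ascentTime_id
  | some i => exact h i

variable {U : Matrix (Fin N) (Fin M) ℝ} {p : Fin N → ℝ} {q : Fin M → ℝ}
  {f : Fin N → EuclideanSpace ℝ (Fin 1) → ℝ} {g : Fin M → EuclideanSpace ℝ (Fin 1) → ℝ}

theorem hasGlobalSolutions_cgdaField (hNash : IsFullyMixedNash U p q)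
    (hfd : ∀ i, Differentiable ℝ (f i)) (hgd : ∀ j, Differentiable ℝ (g j))
    (hf : ∀ i, IsRegularAt (onLine (f i)) (p i)) (hg : ∀ j, IsRegularAt (onLine (g j)) (q j))
    (hfs : ∀ i, Function.Surjective (ascentTime (onLine (f i))))
    (hgs : ∀ j, Function.Surjective (ascentTime (onLine (g j)))) :
    HasGlobalSolutions (cgdaField (n := fun _ => 1) (m := fun _ => 1) U f g) := by
  obtain ⟨v, hUq, hUp⟩ := hNash.indifferent
  have h := hasGlobalSolutions_hiddenField (borderedMatrix U) (isRegularAt_borderedFun v hf)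
    (isRegularAt_borderedFun v hg) (surjective_ascentTime_borderedFun hfs)
    (surjective_ascentTime_borderedFun hgs)
  exact h.map (stateEquiv N M).symm (symm_conj _
    (stateEquiv_cgdaField hNash.left_mem.2 hNash.right_mem.2 hUq hUp hfd hgd))

theorem exists_recurrent_flow_cgdaField (hNash : IsFullyMixedNash U p q)
    (hfd : ∀ i, Differentiable ℝ (f i)) (hgd : ∀ j, Differentiable ℝ (g j))
    (hf : ∀ i, IsRegularAt (onLine (f i)) (p i)) (hg : ∀ j, IsRegularAt (onLine (g j)) (q j))
    (hglob : HasGlobalSolutions (cgdaField (n := fun _ => 1) (m := fun _ => 1) U f g)) :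
    ∃ Φ, IsFlow (cgdaField (n := fun _ => 1) (m := fun _ => 1) U f g) Φ ∧
      IsPoincareRecurrentOn Φ univ := by
  obtain ⟨v, hUq, hUp⟩ := hNash.indifferent
  have hconj := stateEquiv_cgdaField hNash.left_mem.2 hNash.right_mem.2 hUq hUp hfd hgd
  have hf' := isRegularAt_borderedFun v hf
  have hg' := isRegularAt_borderedFun v hg
  obtain ⟨Ψ, hΨ⟩ := exists_isFlow_hiddenField hf' hg' (hglob.map (stateEquiv N M) hconj)
  have hnull := volume_not_isRecurrentPoint_hiddenField hf' hg' hΨ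
  have h1 : (volume : Measure (ℝ × ℝ)).IsAddHaarMeasure :=
    Measure.prod.instIsAddHaarMeasure volume volume
  have h2 : (volume : Measure (((j : Fin M) → EuclideanSpace ℝ (Fin 1)) ×
      ℝ × ℝ)).IsAddHaarMeasure := Measure.prod.instIsAddHaarMeasure volume volume
  have h3 : (volume : Measure (State (fun _ : Fin N => 1) (fun _ : Fin M => 1))).IsAddHaarMeasure :=
    Measure.prod.instIsAddHaarMeasure volume volume
  have h4 : (volume : Measure ((Option (Fin N) → ℝ) × (Option (Fin M) → ℝ))).IsAddHaarMeasure :=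
    Measure.prod.instIsAddHaarMeasure volume volume
  refine ⟨_, hΨ.comap (stateEquiv N M) hconj, isOpen_univ.measure_ne_zero volume univ_nonempty, ?_⟩
  simpa using volume_not_isRecurrentPoint_comap (stateEquiv N M) hnull

lemma lt_one_of_mem_stdSimplex (hN : 2 ≤ N) (hp : p ∈ stdSimplex ℝ (Fin N))
    (hpos : ∀ i, 0 < p i) (i : Fin N) : p i < 1 := by
  have : Nontrivial (Fin N) := Fin.nontrivial_iff_two_le.2 hN
  obtain ⟨k, hk⟩ := exists_ne i
  have := Finset.add_le_sum (s := Finset.univ) (f := p) (fun i _ => (hpos i).le)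
    (Finset.mem_univ i) (Finset.mem_univ k) hk.symm
  rw [hp.2] at this
  linarith [hpos k]

end Lagrangian

end HiddenBilinear

end

theorem mainTheorem2 {N M : ℕ} (U : Matrix (Fin N) (Fin M) ℝ) (p : Fin N → ℝ) (q : Fin M → ℝ)
    (hNash : HiddenBilinear.IsFullyMixedNash U p q) :
    -- sigmoid functions
    (2 ≤ N → 2 ≤ M →
      ∃ Φ : HiddenBilinear.State (fun _ : Fin N => 1) (fun _ : Fin M => 1) → ℝ →
          HiddenBilinear.State (fun _ : Fin N => 1) (fun _ : Fin M => 1),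
        HiddenBilinear.IsFlow
          (HiddenBilinear.cgdaField U (fun _ => HiddenBilinear.sigmoidFun)
            (fun _ => HiddenBilinear.sigmoidFun)) Φ ∧
        HiddenBilinear.IsPoincareRecurrentOn Φ Set.univ) ∧
    -- one-to-one functions for which all initializations are safe
    (∀ (n : Fin N → ℕ) (m : Fin M → ℕ)
      (f : (i : Fin N) → EuclideanSpace ℝ (Fin (n i)) → ℝ)
      (g : (j : Fin M) → EuclideanSpace ℝ (Fin (m j)) → ℝ),
      (∀ i, ContDiff ℝ 2 (f i)) → (∀ j, ContDiff ℝ 2 (g j)) →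
      (∀ i, Function.Injective (f i)) → (∀ j, Function.Injective (g j)) →
      (∀ x : HiddenBilinear.State n m, HiddenBilinear.IsSafe f g p q x) →
      -- the flow exists as soon as the gradient ascent dynamics have global solutions
      (((∀ i, HiddenBilinear.HasGlobalSolutions (gradient (f i))) →
          (∀ j, HiddenBilinear.HasGlobalSolutions (gradient (g j))) →
          HiddenBilinear.HasGlobalSolutions (HiddenBilinear.cgdaField U f g)) ∧
        -- whenever the flow exists, it is Poincaré recurrent
        (HiddenBilinear.HasGlobalSolutions (HiddenBilinear.cgdaField U f g) →
          ∃ Φ : HiddenBilinear.State n m → ℝ → HiddenBilinear.State n m,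
            HiddenBilinear.IsFlow (HiddenBilinear.cgdaField U f g) Φ ∧
            HiddenBilinear.IsPoincareRecurrentOn Φ Set.univ))) := by
  open HiddenBilinear in
  refine ⟨fun hN hM => ?_, fun n m f g hf hg hfi hgi hsafe => ?_⟩
  · have hp := fun i => isRegularAt_onLine_sigmoidFun (hNash.left_pos i)
      (lt_one_of_mem_stdSimplex hN hNash.left_mem hNash.left_pos i)
    have hq := fun j => isRegularAt_onLine_sigmoidFun (hNash.right_pos j)
      (lt_one_of_mem_stdSimplex hM hNash.right_mem hNash.right_pos j)
    exact exists_recurrent_flow_cgdaField hNash (fun _ => differentiable_sigmoidFun)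
      (fun _ => differentiable_sigmoidFun) hp hq
      (hasGlobalSolutions_cgdaField hNash (fun _ => differentiable_sigmoidFun)
        (fun _ => differentiable_sigmoidFun) hp hq
        (fun _ => surjective_ascentTime_onLine_sigmoidFun)
        (fun _ => surjective_ascentTime_onLine_sigmoidFun))
  · obtain rfl : n = fun _ => 1 := funext fun i =>
      eq_one_of_injective_of_gradient_ne_zero (hf i).continuous (hfi i)
        ((hsafe 0).left_nonstationary i)
    obtain rfl : m = fun _ => 1 := funext fun j =>
      eq_one_of_injective_of_gradient_ne_zero (hg j).continuous (hgi j)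
        ((hsafe 0).right_nonstationary j)
    have hfd : ∀ i, Differentiable ℝ (f i) := fun i => (hf i).differentiable (by norm_num)
    have hgd : ∀ j, Differentiable ℝ (g j) := fun j => (hg j).differentiable (by norm_num)
    have hf' : ∀ i, IsRegularAt (onLine (f i)) (p i) := fun i => by
      refine isRegularAt_onLine (hf i)
        (fun x => (hsafe (fun _ => x, 0, 0, 0)).left_nonstationary i) ?_
      obtain ⟨I, γ, -, -, -, -, -, t, -, ht⟩ := (hsafe 0).left_attained i
      exact ⟨γ t, ht⟩
    have hg' : ∀ j, IsRegularAt (onLine (g j)) (q j) := fun j => by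
      refine isRegularAt_onLine (hg j)
        (fun x => (hsafe (0, fun _ => x, 0, 0)).right_nonstationary j) ?_
      obtain ⟨I, γ, -, -, -, -, -, t, -, ht⟩ := (hsafe 0).right_attained j
      exact ⟨γ t, ht⟩
    refine ⟨fun hfg hgg => ?_, exists_recurrent_flow_cgdaField hNash hfd hgd hf' hg'⟩
    exact hasGlobalSolutions_cgdaField hNash hfd hgd hf' hg'
      (fun i => surjective_ascentTime (hf' i).contDiff (hf' i).deriv_ne_zero
        (hasGlobalSolutions_onLine (hfd i) (hfg i)))
      (fun j => surjective_ascentTime (hg' j).contDiff (hg' j).deriv_ne_zero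
        (hasGlobalSolutions_onLine (hgd j) (hgg j)))
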